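/- Let $(W',S')$ be an arbitrary Coxeter system, let $(W,S)=(W',S')\times(W',S')$ be the product Coxeter system, so $W=W'\times W'$ and $S=\{(s,1)\}\cup\{(1,s)\}$ with $s\in S'$, and let $*$ be the automorphism $(x,y)^*=(y,x)$ of $W$. Write $\mathbf I_*=\{w\in W: w^*=w^{-1}\}$, let $\le$ denote the Bruhat order and $\ell$ the length function, put $\mathcal A=\mathbb Z[v,v^{-1}]$, $q=v^2$, and let bars denote the bar operators. For any Coxeter system, $\mathcal H_{q}$ (resp. $\mathcal H_{q^2}$) is the Hecke algebra with parameter $u=q$ (resp. $u=q^2$) and standard basis $t_w$ (resp. $T_w$): $t_st_w=t_{sw}$ if $sw>w$ and $t_st_w=u\,t_{sw}+(u-1)t_w$ if $sw<w$. Its bar operator is the ring involution with $\overline{v}=v^{-1}$, $\overline{t_w}=(t_{w^{-1}})^{-1}$. The Kazhdan–Lusztig polynomials $P_{y,w}\in\mathbb Z[q]$ are determined by: $c_w=v^{-\ell(w)}\sum_yP_{y,w}t_y\in\mathcal H_q$ is bar invariant; $P_{y,w}=\delta_{y,w}$ unless $y<w$; $\deg_q P_{y,w}\le\frac12(\ell(w)-\ell(y)-1)$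 if $y<w$. Define $h_{x,y;z}\in\mathcal A$ by $c_xc_y=\sum_zh_{x,y;z}c_z$, and put $C_w=q^{-\ell(w)}\sum_yP_{y,w}(q^2)T_y\in\mathcal H_{q^2}$. For $s\in S$ and $w\in\mathbf I_*$ put $s\ltimes w=sw$ if $sws^*=w$, and $s\ltimes w=sws^*$ otherwise. Let $\mathcal M_{q^2}$ be the $\mathcal H_{q^2}$-module with $\mathcal A$-basis $a_w$ ($w\in\mathbf I_*$) in which $T_sa_w$ equals $a_{s\ltimes w}$ if $s\ltimes w=sws^*>w$; $(q+1)a_{s\ltimes w}+qa_w$ if $s\ltimes w=sw>w$; $(q^2-q)a_{s\ltimes w}+(q^2-q-1)a_w$ if $s\ltimes w=sw<w$; $q^2a_{s\ltimes w}+(q^2-1)a_w$ if $s\ltimes w=sws^*<w$. Its bar operator is the unique $\mathbb Z$-linear involution with $\overline{a_1}=a_1$ and $\overline{hm}=\overline h\,\overline m$. The twisted polynomials $P^\sigma_{y,w}\in\mathbb Z[q]$ ($y,w\in\mathbf I_*$) are determined by: $A_w=v^{-\ell(w)}\sum_{y\in\mathbf I_*}P^\sigma_{y,w}a_y$ is bar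 invariant; $P^\sigma_{y,w}=\delta_{y,w}$ unless $y<w$; $\deg_qP^\sigma_{y,w}\le\frac12(\ell(w)-\ell(y)-1)$ if $y<w$. For $x\in W$ and $y\in\mathbf I_*$ define $\widetilde h_{x,y;z}$ ($z\in W$) and $h^\sigma_{x,y;z}$ ($z\in\mathbf I_*$) in $\mathcal A$ by $c_xc_yc_{(x^*)^{-1}}=\sum_{z\in W}\widetilde h_{x,y;z}c_z$ and $C_xA_y=\sum_{z\in\mathbf I_*}h^\sigma_{x,y;z}A_z$. Finally put $$P^\pm_{y,w}=\tfrac12(P_{y,w}\pm P^\sigma_{y,w})\ (y,w\in\mathbf I_*),\qquad h^\pm_{x,y;z}=\tfrac12(\widetilde h_{x,y;z}\pm h^\sigma_{x,y;z})\ (x\in W,\ y,z\in\mathbf I_*).$$ Then for each choice of the sign $\pm$ (the same throughout each formula) the following hold, where the left sides refer to $(W,S,*)$ and the polynomials $P_{y,w}$, $h_{x,y;z}$ on the right sides are those of $(W',S')$. (a) $\{P^\pm_{y,w}: y,w\in\mathbf I_*\}=\{\tfrac12(P_{y,w}(q)^2\pm P_{y,w}(q^2)): y,w\in W'\}$. (b)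 $\{P^\pm_{y,w}-P^\pm_{z,w}: y,z,w\in\mathbf I_*,\ y\le z\}=\{\tfrac12(P_{y,w}(q)^2-P_{z,w}(q)^2)\pm\tfrac12(P_{y,w}(q^2)-P_{z,w}(q^2)): y,z,w\in W',\ y\le z\}$. (c) $\{h^\pm_{x,y;z}: x\in W,\ y,z\in\mathbf I_*\}=\{\tfrac12(f_{w,x,y;z}(v)^2\pm f_{w,x,y;z}(v^2)): w,x,y,z\in W'\}$, where $f_{w,x,y;z}=\sum_{g\in W'}h_{w,x;g}h_{g,y;z}\in\mathcal A$. -/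

import Mathlib

open Polynomial
open scoped LaurentPolynomial

noncomputable section

/-! ### Coxeter combinatorics: the Bruhat order and the product of two Coxeter systems -/

namespace CoxeterSystem

variable {B W : Type*} [Group W] {M : CoxeterMatrix B} (cs : CoxeterSystem M W)

/-- The Bruhat order `y ≤ w`: there is a chain from `y` to `w` in which each step multiplies by a
reflection and increases the length. -/
def BruhatLE (y w : W) : Prop :=
  Relation.ReflTransGen
    (fun a b => ∃ t, cs.IsReflection t ∧ b = t * a ∧ cs.length a < cs.length b) y w

/-- The strict Bruhat order. -/
def BruhatLT (y w : W) : Prop := cs.BruhatLE y w ∧ y ≠ w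

theorem length_le_of_bruhatLE {y w : W} (h : cs.BruhatLE y w) :
    y = w ∨ cs.length y < cs.length w := by
  unfold BruhatLE at h
  induction h with
  | refl => exact Or.inl rfl
  | tail _ hs ih =>
    obtain ⟨t, _, _, hlt⟩ := hs
    rcases ih with rfl | ih
    · exact Or.inr hlt
    · exact Or.inr (ih.trans hlt)

theorem bruhatLT_simple_mul_iff (w : W) (i : B) :
    cs.BruhatLT w (cs.simple i * w) ↔ cs.length w < cs.length (cs.simple i * w) := by
  constructor
  · rintro ⟨h, hne⟩
    exact (cs.length_le_of_bruhatLE h).resolve_left hne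
  · intro h
    refine ⟨Relation.ReflTransGen.single ⟨_, cs.isReflection_simple i, rfl, h⟩, ?_⟩
    intro he
    rw [← he] at h
    exact lt_irrefl _ h

section Exchange

open Classical in
/-- Auxiliary: the action of a simple reflection on pairs (group element, parity). -/
def parityStep (i : B) : Function.End (W × ZMod 2) := fun p =>
  (cs.simple i * p.1 * cs.simple i, p.2 + if p.1 = cs.simple i then 1 else 0)

open Classical in
theorem parityStep_prod (ω : List B) (p : W × ZMod 2) :
    (ω.map cs.parityStep).prod p =
      (cs.wordProd ω * p.1 * (cs.wordProd ω)⁻¹,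
        p.2 + ((cs.rightInvSeq ω).count p.1 : ZMod 2)) := by
  induction ω with
  | nil =>
    change p = _
    simp
  | cons i ω ih =>
    rw [List.map_cons, List.prod_cons]
    change cs.parityStep i ((ω.map cs.parityStep).prod p) = _
    rw [ih]
    simp only [parityStep, wordProd_cons, rightInvSeq, List.count_cons, mul_inv_rev, inv_simple,
      mul_assoc, Nat.cast_add, add_assoc, Nat.cast_ite, Nat.cast_one, Nat.cast_zero, beq_iff_eq]
    have : (cs.wordProd ω * (p.1 * (cs.wordProd ω)⁻¹) = cs.simple i) ↔
        ((cs.wordProd ω)⁻¹ * (cs.simple i * cs.wordProd ω) = p.1) := by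
      constructor
      · intro h
        rw [← h]; group
      · intro h
        rw [← h]; group
    simp [this]

theorem parityStep_alternating (i j : B) (m : ℕ) :
    ((CoxeterSystem.alternatingWord i j (2 * m)).reverse.map cs.parityStep).prod =
      (cs.parityStep j * cs.parityStep i) ^ m := by
  induction m with
  | zero => simp [alternatingWord]
  | succ m ih =>
    rw [pow_succ', ← ih, show 2 * (m + 1) = 2 * m + 1 + 1 by ring, alternatingWord_succ,
      alternatingWord_succ]
    simp [mul_assoc]

theorem parityStep_isLiftable : M.IsLiftable cs.parityStep := by
  classical
  intro j i
  rw [← parityStep_alternating]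
  funext p
  rw [parityStep_prod, rightInvSeq_reverse, List.count_reverse, wordProd_reverse, inv_inv]
  have hL : cs.leftInvSeq (alternatingWord i j (2 * M j i)) =
      (List.range (2 * M j i)).map (fun k => cs.simple i * (cs.simple j * cs.simple i) ^ k) := by
    apply List.ext_getElem
    · simp
    · intro k h1 h2
      rw [cs.getElem_leftInvSeq_alternatingWord i j (M j i) k (by simpa using h1),
        prod_alternatingWord_eq_mul_pow]
      simp [Nat.mul_add_div]
  have hw : cs.wordProd (alternatingWord i j (2 * M j i)) = 1 := by
    rw [prod_alternatingWord_eq_mul_pow]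
    simp
  have hc : (((cs.leftInvSeq (alternatingWord i j (2 * M j i))).count p.1 : ℕ) : ZMod 2) = 0 := by
    rw [hL, two_mul, List.range_add, List.map_append, List.map_map, List.count_append]
    have : ((fun k => cs.simple i * (cs.simple j * cs.simple i) ^ k) ∘ fun x => M j i + x) =
        (fun k => cs.simple i * (cs.simple j * cs.simple i) ^ k) := by
      funext k
      simp [pow_add]
    rw [this, Nat.cast_add, CharTwo.add_self_eq_zero]
  rw [hc, hw]
  change _ = p
  simp

open Classical in
theorem count_rightInvSeq_congr {ω ω' : List B} (h : cs.wordProd ω = cs.wordProd ω') (t : W) :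
    ((cs.rightInvSeq ω).count t : ZMod 2) = ((cs.rightInvSeq ω').count t : ZMod 2) := by
  have key : ∀ ω : List B, (cs.lift ⟨cs.parityStep, cs.parityStep_isLiftable⟩) (cs.wordProd ω) =
      (ω.map cs.parityStep).prod := by
    intro ω
    rw [wordProd, map_list_prod, List.map_map]
    congr 1
    apply List.map_congr_left
    intro i _
    simp
  have h2 := congrFun ((key ω).symm.trans ((congrArg _ h).trans (key ω'))) (t, 0)
  rw [parityStep_prod, parityStep_prod] at h2
  simpa using congrArg Prod.snd h2

/-- The exchange condition: a right descent occurs in the right inversion sequence of any word. -/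
theorem mem_rightInvSeq_of_descent (ω : List B) (j : B)
    (h : cs.length (cs.wordProd ω * cs.simple j) < cs.length (cs.wordProd ω)) :
    cs.simple j ∈ cs.rightInvSeq ω := by
  classical
  obtain ⟨ω', hr, hω'⟩ := cs.exists_isReduced (cs.wordProd ω * cs.simple j)
  by_contra hn
  have h0 : (cs.rightInvSeq ω).count (cs.simple j) = 0 := List.count_eq_zero.2 hn
  have e1 : cs.wordProd (ω'.concat j) = cs.wordProd ω := by
    rw [wordProd_concat, ← hω']; simp
  have h1 := cs.count_rightInvSeq_congr e1 (cs.simple j)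
  rw [h0, rightInvSeq_concat] at h1
  have hm : cs.simple j ∈ cs.rightInvSeq ω' := by
    by_contra hn'
    have : (List.map (MulAut.conj (cs.simple j)) (cs.rightInvSeq ω')).count (cs.simple j) = 0 := by
      rw [List.count_eq_zero]
      intro hmem
      obtain ⟨x, hx, hxe⟩ := List.mem_map.1 hmem
      have hx2 : x = cs.simple j := by
        rw [MulAut.conj_apply, inv_simple] at hxe
        have := congrArg (fun z => cs.simple j * z * cs.simple j) hxe
        simpa [mul_assoc] using this
      exact hn' (hx2 ▸ hx)
    rw [List.concat_eq_append, List.count_append, this] at h1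
    simp at h1
  have h3 := (cs.isRightInversion_of_mem_rightInvSeq hr hm).2
  rw [← hω', mul_assoc, simple_mul_simple_self, mul_one] at h3
  omega

theorem simple_mul_eq_mul_simple_of_lt {w : W} {i j : B}
    (h1 : cs.length (cs.simple i * w * cs.simple j) = cs.length w)
    (h2 : cs.length (cs.simple i * w) = cs.length (w * cs.simple j))
    (h3 : cs.length w < cs.length (cs.simple i * w)) :
    cs.simple i * w = w * cs.simple j := by
  obtain ⟨ω, hr, rfl⟩ := cs.exists_isReduced w
  have hm := cs.mem_rightInvSeq_of_descent (i :: ω) j (by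
    rw [wordProd_cons, h1]; exact h3)
  rw [rightInvSeq, List.mem_cons] at hm
  rcases hm with hm | hm
  · rw [hm]; group
  · have := (cs.isRightInversion_of_mem_rightInvSeq hr hm).2
    omega

theorem simple_mul_eq_mul_simple {w : W} {i j : B}
    (h1 : cs.length (cs.simple i * w * cs.simple j) = cs.length w)
    (h2 : cs.length (cs.simple i * w) = cs.length (w * cs.simple j)) :
    cs.simple i * w = w * cs.simple j := by
  rcases cs.length_simple_mul w i with h | h
  · exact cs.simple_mul_eq_mul_simple_of_lt h1 h2 (by omega)
  · have := cs.simple_mul_eq_mul_simple_of_lt (w := cs.simple i * w) (i := i) (j := j)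
      (by simpa using h2.symm) (by simpa using h1.symm) (by simp; omega)
    rw [simple_mul_simple_cancel_left] at this
    conv_rhs => rw [this]
    simp

end Exchange

end CoxeterSystem

/-- The Coxeter matrix of a direct product: generators of different factors commute. -/
def CoxeterMatrix.prod {B B' : Type*} (M : CoxeterMatrix B) (M' : CoxeterMatrix B') :
    CoxeterMatrix (B ⊕ B') where
  M := Matrix.fromBlocks M.M (Matrix.of fun _ _ => 2) (Matrix.of fun _ _ => 2) M'.M
  isSymm := by
    ext i j
    rcases i with i | i <;> rcases j with j | j
    · simp [M.symmetric i j]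
    · simp
    · simp
    · simp [M'.symmetric i j]
  diagonal i := by rcases i with i | i <;> simp
  off_diagonal i j h := by
    rcases i with i | i <;> rcases j with j | j <;> simp
    · exact M.off_diagonal i j (fun e => h (by rw [e]))
    · exact M'.off_diagonal i j (fun e => h (by rw [e]))

namespace CoxeterSystem

section Prod

variable {B B' W W' : Type*} [Group W] [Group W'] {M : CoxeterMatrix B} {M' : CoxeterMatrix B'}
variable (cs : CoxeterSystem M W) (cs' : CoxeterSystem M' W')

/-- The simple generators `(s, 1)` and `(1, s')` of a direct product. -/
def prodSimple : B ⊕ B' → W × W' := Sum.elim (fun i => (cs.simple i, 1)) fun j => (1, cs'.simple j)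

theorem prodSimple_isLiftable : (M.prod M').IsLiftable (prodSimple cs cs') := by
  intro i j
  rcases i with i | i <;> rcases j with j | j
  · exact Prod.ext (by simp [prodSimple, CoxeterMatrix.prod])
      (by simp [prodSimple])
  · simp [prodSimple, CoxeterMatrix.prod, pow_two]
  · simp [prodSimple, CoxeterMatrix.prod, pow_two]
  · exact Prod.ext (by simp [prodSimple])
      (by simp [prodSimple, CoxeterMatrix.prod])

theorem inl_isLiftable : M.IsLiftable (fun i => (M.prod M').simple (Sum.inl i)) := fun i j =>
  (M.prod M').toCoxeterSystem.simple_mul_simple_pow (Sum.inl i) (Sum.inl j)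

theorem inr_isLiftable : M'.IsLiftable (fun i => (M.prod M').simple (Sum.inr i)) := fun i j =>
  (M.prod M').toCoxeterSystem.simple_mul_simple_pow (Sum.inr i) (Sum.inr j)

theorem inl_inr_commute (w : W) (w' : W') :
    Commute (cs.lift ⟨_, inl_isLiftable (M := M) (M' := M')⟩ w)
      (cs'.lift ⟨_, inr_isLiftable (M := M) (M' := M')⟩ w') := by
  have hc : ∀ i j, Commute ((M.prod M').simple (Sum.inl i)) ((M.prod M').simple (Sum.inr j)) := by
    intro i j
    have h := (M.prod M').toCoxeterSystem.simple_mul_simple_pow (Sum.inl i) (Sum.inr j)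
    have h2 : (M.prod M') (Sum.inl i) (Sum.inr j) = 2 := rfl
    rw [h2, pow_two, mul_eq_one_iff_eq_inv, mul_inv_rev, inv_simple, inv_simple] at h
    exact h
  induction w using cs.simple_induction_left with
  | one => simp
  | mul_simple_left w i ih =>
    rw [map_mul]
    refine Commute.mul_left ?_ ih
    rw [lift_apply_simple]
    clear ih
    induction w' using cs'.simple_induction_left with
    | one => simp
    | mul_simple_left w' j ih =>
      rw [map_mul]
      refine Commute.mul_right ?_ ih
      rw [lift_apply_simple]
      exact hc i j

theorem prod_hom_ext {G : Type*} [Monoid G] {φ ψ : W × W' →* G}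
    (h1 : φ.comp (MonoidHom.inl W W') = ψ.comp (MonoidHom.inl W W'))
    (h2 : φ.comp (MonoidHom.inr W W') = ψ.comp (MonoidHom.inr W W')) : φ = ψ := by
  ext ⟨a, b⟩
  have e : ((a, b) : W × W') = (a, 1) * (1, b) := by simp
  have h1' : φ (a, 1) = ψ (a, 1) := DFunLike.congr_fun h1 a
  have h2' : φ (1, b) = ψ (1, b) := DFunLike.congr_fun h2 b
  rw [e, map_mul, map_mul, h1', h2']

/-- The direct product `(W, S) × (W', S')` of two Coxeter systems: the group is `W × W'`, and the
simple reflections are the pairs `(s, 1)` and `(1, s')`. -/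
def prod : CoxeterSystem (M.prod M') (W × W') where
  mulEquiv := MonoidHom.toMulEquiv
    (MonoidHom.noncommCoprod (cs.lift ⟨_, inl_isLiftable (M := M) (M' := M')⟩)
      (cs'.lift ⟨_, inr_isLiftable (M := M) (M' := M')⟩) (inl_inr_commute cs cs'))
    ((M.prod M').toCoxeterSystem.lift ⟨prodSimple cs cs', prodSimple_isLiftable cs cs'⟩)
    (by
      apply prod_hom_ext
      · apply cs.ext_simple
        intro i
        simp only [MonoidHom.comp_apply, MonoidHom.inl_apply, MonoidHom.noncommCoprod_apply,
          map_one, mul_one, lift_apply_simple, MonoidHom.id_apply]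
        exact (M.prod M').toCoxeterSystem.lift_apply_simple (prodSimple_isLiftable cs cs') (Sum.inl i)
      · apply cs'.ext_simple
        intro i
        simp only [MonoidHom.comp_apply, MonoidHom.inr_apply, MonoidHom.noncommCoprod_apply,
          map_one, one_mul, lift_apply_simple, MonoidHom.id_apply]
        exact (M.prod M').toCoxeterSystem.lift_apply_simple (prodSimple_isLiftable cs cs') (Sum.inr i))
    (by
      apply (M.prod M').toCoxeterSystem.ext_simple
      intro i
      rw [MonoidHom.comp_apply, lift_apply_simple]
      rcases i with i | i <;> simp [prodSimple])

theorem prod_simple_inl (i : B) : (cs.prod cs').simple (Sum.inl i) = (cs.simple i, 1) :=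
  (M.prod M').toCoxeterSystem.lift_apply_simple (prodSimple_isLiftable cs cs') (Sum.inl i)

theorem prod_simple_inr (i : B') : (cs.prod cs').simple (Sum.inr i) = (1, cs'.simple i) :=
  (M.prod M').toCoxeterSystem.lift_apply_simple (prodSimple_isLiftable cs cs') (Sum.inr i)

end Prod

end CoxeterSystem

/-! ### The Hecke algebra -/

section Hecke

variable {B W : Type*} [Group W] {M : CoxeterMatrix B} {R : Type*} [CommRing R]

/-- A reduced word for `w`. -/
def CoxeterSystem.reducedWord (cs : CoxeterSystem M W) (w : W) : List B :=
  (cs.exists_isReduced w).choose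

theorem CoxeterSystem.isReduced_reducedWord (cs : CoxeterSystem M W) (w : W) :
    cs.IsReduced (cs.reducedWord w) := (cs.exists_isReduced w).choose_spec.1

theorem CoxeterSystem.wordProd_reducedWord (cs : CoxeterSystem M W) (w : W) :
    cs.wordProd (cs.reducedWord w) = w := (cs.exists_isReduced w).choose_spec.2.symm

open Classical in
/-- The operator `t_w ↦ t_s t_w` on the free module with basis `t_w`: it sends `t_w` to `t_{sw}` if
`sw > w`, and to `u t_{sw} + (u - 1) t_w` if `sw < w`. -/
def heckeLeft (cs : CoxeterSystem M W) (u : R) (i : B) : (W →₀ R) →ₗ[R] (W →₀ R) :=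
  Finsupp.linearCombination R fun w =>
    if cs.BruhatLT w (cs.simple i * w) then Finsupp.single (cs.simple i * w) 1
    else u • Finsupp.single (cs.simple i * w) 1 + (u - 1) • Finsupp.single w 1

/-- Auxiliary: the mirror image of `heckeLeft`. -/
def heckeRight (cs : CoxeterSystem M W) (u : R) (i : B) : (W →₀ R) →ₗ[R] (W →₀ R) :=
  Finsupp.linearCombination R fun w =>
    if cs.length w < cs.length (w * cs.simple i) then Finsupp.single (w * cs.simple i) 1
    else u • Finsupp.single (w * cs.simple i) 1 + (u - 1) • Finsupp.single w 1

open Classical in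
theorem heckeLeft_single (cs : CoxeterSystem M W) (u : R) (i : B) (w : W) :
    heckeLeft cs u i (Finsupp.single w 1) =
      if cs.length w < cs.length (cs.simple i * w) then Finsupp.single (cs.simple i * w) 1
      else u • Finsupp.single (cs.simple i * w) 1 + (u - 1) • Finsupp.single w 1 := by
  simp only [heckeLeft, Finsupp.linearCombination_single, one_smul, cs.bruhatLT_simple_mul_iff]

theorem heckeRight_single (cs : CoxeterSystem M W) (u : R) (i : B) (w : W) :
    heckeRight cs u i (Finsupp.single w 1) =
      if cs.length w < cs.length (w * cs.simple i) then Finsupp.single (w * cs.simple i) 1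
      else u • Finsupp.single (w * cs.simple i) 1 + (u - 1) • Finsupp.single w 1 := by
  simp only [heckeRight, Finsupp.linearCombination_single, one_smul]

theorem heckeLeft_heckeRight (cs : CoxeterSystem M W) (u : R) (i j : B) :
    Commute (heckeLeft cs u i) (heckeRight cs u j) := by
  change heckeLeft cs u i ∘ₗ heckeRight cs u j = heckeRight cs u j ∘ₗ heckeLeft cs u i
  refine Finsupp.lhom_ext' fun w => LinearMap.ext_ring ?_
  change heckeLeft cs u i (heckeRight cs u j (Finsupp.single w 1)) =
    heckeRight cs u j (heckeLeft cs u i (Finsupp.single w 1))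
  have key : cs.length (cs.simple i * w * cs.simple j) = cs.length w →
      cs.length (cs.simple i * w) = cs.length (w * cs.simple j) →
      cs.simple i * w = w * cs.simple j := cs.simple_mul_eq_mul_simple
  have a1 := cs.length_simple_mul w i
  have a2 := cs.length_mul_simple w j
  have a3 := cs.length_mul_simple (cs.simple i * w) j
  have a4 := cs.length_simple_mul (w * cs.simple j) i
  rw [← mul_assoc] at a4
  rw [heckeLeft_single, heckeRight_single]
  by_cases h1 : cs.length w < cs.length (cs.simple i * w) <;>
  by_cases h2 : cs.length w < cs.length (w * cs.simple j)
  all_goals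
    simp only [h1, h2, if_true, if_false, map_add, map_smul, heckeLeft_single, heckeRight_single,
      ← mul_assoc]
    by_cases h3 : cs.length (cs.simple i * w) < cs.length (cs.simple i * w * cs.simple j) <;>
    by_cases h4 : cs.length (w * cs.simple j) < cs.length (cs.simple i * w * cs.simple j)
  all_goals
    first
    | (exfalso; omega)
    | (simp only [h3, h4, if_true, if_false]; first | done | module)
    | (have k := key (by omega) (by omega)
       simp [h3, h4, k, mul_assoc, CoxeterSystem.simple_mul_simple_self])

/-- The product of the operators `heckeLeft` along a reduced word of `w`: multiplication by `t_w`. -/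
def heckeOp (cs : CoxeterSystem M W) (u : R) (w : W) : Module.End R (W →₀ R) :=
  ((cs.reducedWord w).map (heckeLeft cs u)).prod

/-- Left multiplication by `∑ r_w t_w`. -/
def heckeLmul (cs : CoxeterSystem M W) (u : R) : (W →₀ R) →ₗ[R] Module.End R (W →₀ R) :=
  Finsupp.linearCombination R (heckeOp cs u)

theorem heckeLeft_word (cs : CoxeterSystem M W) (u : R) (ω : List B) (h : cs.IsReduced ω) :
    (ω.map (heckeLeft cs u)).prod (Finsupp.single 1 1) = Finsupp.single (cs.wordProd ω) 1 := by
  induction ω with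
  | nil => simp
  | cons i ω ih =>
    have h' : cs.IsReduced ω := by simpa using h.drop 1
    rw [List.map_cons, List.prod_cons, Module.End.mul_apply, ih h', heckeLeft_single,
      CoxeterSystem.wordProd_cons, if_pos]
    have h1 := h.eq
    rw [CoxeterSystem.wordProd_cons, List.length_cons] at h1
    rw [h1, h'.eq]
    exact Nat.lt_succ_self _

theorem heckeLmul_one (cs : CoxeterSystem M W) (u : R) (x : W →₀ R) :
    heckeLmul cs u x (Finsupp.single 1 1) = x := by
  induction x using Finsupp.induction_linear with
  | zero => simp
  | add x y hx hy => rw [map_add, LinearMap.add_apply, hx, hy]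
  | single w r =>
    rw [heckeLmul, Finsupp.linearCombination_single, LinearMap.smul_apply, heckeOp,
      heckeLeft_word cs u _ (cs.isReduced_reducedWord w), cs.wordProd_reducedWord]
    simp

theorem heckeLmul_commute (cs : CoxeterSystem M W) (u : R) (x : W →₀ R) (j : B) :
    Commute (heckeLmul cs u x) (heckeRight cs u j) := by
  induction x using Finsupp.induction_linear with
  | zero => simp
  | add x y hx hy => rw [map_add]; exact hx.add_left hy
  | single w r =>
    rw [heckeLmul, Finsupp.linearCombination_single]
    refine Commute.smul_left ?_ r
    rw [heckeOp]
    refine Commute.list_prod_left _ _ ?_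
    intro f hf
    obtain ⟨i, _, rfl⟩ := List.mem_map.1 hf
    exact heckeLeft_heckeRight cs u i j

/-- An operator commuting with all `heckeRight` operators is determined by its value at `t_1`. -/
theorem hecke_ext (cs : CoxeterSystem M W) (u : R) {f g : Module.End R (W →₀ R)}
    (hf : ∀ j, Commute f (heckeRight cs u j)) (hg : ∀ j, Commute g (heckeRight cs u j))
    (h : f (Finsupp.single 1 1) = g (Finsupp.single 1 1)) : f = g := by
  have key : ∀ n : ℕ, ∀ w : W, cs.length w = n →
      f (Finsupp.single w 1) = g (Finsupp.single w 1) := by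
    intro n
    induction n with
    | zero =>
      intro w hw
      rw [cs.length_eq_zero_iff.1 hw, h]
    | succ n ih =>
      intro w hw
      have hne : w ≠ 1 := by rintro rfl; simp at hw
      obtain ⟨j, hj⟩ := cs.exists_rightDescent_of_ne_one hne
      have hl := cs.isRightDescent_iff.1 hj
      have e : Finsupp.single w 1 =
          heckeRight cs u j (Finsupp.single (w * cs.simple j) (1 : R)) := by
        rw [heckeRight_single, CoxeterSystem.simple_mul_simple_cancel_right, if_pos (by omega)]
      have c1 := DFunLike.congr_fun (hf j).eq (Finsupp.single (w * cs.simple j) (1 : R))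
      have c2 := DFunLike.congr_fun (hg j).eq (Finsupp.single (w * cs.simple j) (1 : R))
      simp only [Module.End.mul_apply] at c1 c2
      rw [e, c1, c2, ih _ (by omega)]
  refine Finsupp.lhom_ext' fun w => LinearMap.ext_ring ?_
  exact key _ w rfl

theorem heckeLmul_mul (cs : CoxeterSystem M W) (u : R) (x y : W →₀ R) :
    heckeLmul cs u (heckeLmul cs u x y) = heckeLmul cs u x * heckeLmul cs u y := by
  apply hecke_ext cs u (heckeLmul_commute cs u _)
  · intro j
    exact (heckeLmul_commute cs u x j).mul_left (heckeLmul_commute cs u y j)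
  · rw [heckeLmul_one, Module.End.mul_apply, heckeLmul_one]

theorem heckeLmul_single_one (cs : CoxeterSystem M W) (u : R) :
    heckeLmul cs u (Finsupp.single 1 1) = 1 := by
  apply hecke_ext cs u (heckeLmul_commute cs u _)
  · intro j
    exact Commute.one_left _
  · rw [heckeLmul_one, Module.End.one_apply]

/-- The Hecke algebra of a Coxeter system with parameter `u`: the free `R`-module with basis
`t_w`, `w ∈ W`, with the multiplication determined by `t_s t_w = t_{sw}` if `sw > w` and
`t_s t_w = u t_{sw} + (u - 1) t_w` if `sw < w`. -/
@[nolint unusedArguments]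
def HeckeAlgebra (_cs : CoxeterSystem M W) (_u : R) : Type _ := W →₀ R

namespace HeckeAlgebra

variable (cs : CoxeterSystem M W) (u : R)

instance : AddCommGroup (HeckeAlgebra cs u) := inferInstanceAs (AddCommGroup (W →₀ R))

instance : Module R (HeckeAlgebra cs u) := inferInstanceAs (Module R (W →₀ R))

/-- The standard basis element `t_w`. -/
def t (w : W) : HeckeAlgebra cs u := (Finsupp.single w 1 : W →₀ R)

instance : Ring (HeckeAlgebra cs u) where
  __ := (inferInstance : AddCommGroup (HeckeAlgebra cs u))
  mul x y := heckeLmul cs u x y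
  one := t cs u 1
  left_distrib x y z := map_add (heckeLmul cs u x) y z
  right_distrib x y z := by
    change heckeLmul cs u (x + y) z = heckeLmul cs u x z + heckeLmul cs u y z
    exact LinearMap.congr_fun (map_add (heckeLmul cs u) x y) z
  zero_mul x := by
    change heckeLmul cs u 0 x = 0
    rw [map_zero]; rfl
  mul_zero x := map_zero (heckeLmul cs u x)
  mul_assoc x y z := by
    exact LinearMap.congr_fun (heckeLmul_mul cs u x y) z
  one_mul x := by
    change heckeLmul cs u (Finsupp.single 1 1) x = x
    rw [heckeLmul_single_one]; rfl
  mul_one x := heckeLmul_one cs u x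

instance : Algebra R (HeckeAlgebra cs u) := Algebra.ofModule
  (fun r x y => by
    change heckeLmul cs u (r • (show W →₀ R from x)) y = r • heckeLmul cs u x y
    rw [map_smul]; rfl)
  (fun r x y => map_smul (heckeLmul cs u x) r y)

theorem one_def : (1 : HeckeAlgebra cs u) = t cs u 1 := rfl

open Classical in
/-- The defining multiplication rule of the Hecke algebra. -/
theorem t_simple_mul_t (i : B) (w : W) : t cs u (cs.simple i) * t cs u w =
    if cs.BruhatLT w (cs.simple i * w) then t cs u (cs.simple i * w)
    else u • t cs u (cs.simple i * w) + (u - 1) • t cs u w := by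
  have h : heckeLmul cs u (Finsupp.single (cs.simple i) 1) = heckeLeft cs u i := by
    apply hecke_ext cs u (heckeLmul_commute cs u _)
    · exact heckeLeft_heckeRight cs u i
    · rw [heckeLmul_one, heckeLeft_single, if_pos (by simp), mul_one]
  change heckeLmul cs u (Finsupp.single (cs.simple i) 1) (Finsupp.single w 1) = _
  rw [h, heckeLeft, Finsupp.linearCombination_single, one_smul]
  rfl

end HeckeAlgebra

end Hecke

/-! ### Kazhdan-Lusztig polynomials

The ground ring is `ℤ[T;T⁻¹]`, whose variable `T 1` is `v`, and `q = v ^ 2 = T 2`. Elements of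
`ℤ[q]` are represented by polynomials in `ℤ[X]`. -/

section KazhdanLusztig

open LaurentPolynomial (T)

variable {B W : Type*} [Group W] {M : CoxeterMatrix B} (cs : CoxeterSystem M W)

/-- The bar operator of a Hecke algebra over `ℤ[v, v⁻¹]`: the additive map with
`r t_w ↦ r(v⁻¹) (t_{w⁻¹})⁻¹`. -/
def heckeBar (u : ℤ[T;T⁻¹]) (x : HeckeAlgebra cs u) : HeckeAlgebra cs u :=
  Finsupp.sum (show W →₀ ℤ[T;T⁻¹] from x) fun w r =>
    LaurentPolynomial.invert r • Ring.inverse (HeckeAlgebra.t cs u w⁻¹)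

/-- The element `v^{-ℓ(w)} ∑_y P_y(q) t_y` of the Hecke algebra with parameter `q`. -/
def klCombination (w : W) (P : W →₀ ℤ[X]) : HeckeAlgebra cs (T 2 : ℤ[T;T⁻¹]) :=
  (T (-(cs.length w : ℤ)) : ℤ[T;T⁻¹]) •
    P.sum fun y p => aeval (T 2 : ℤ[T;T⁻¹]) p • HeckeAlgebra.t cs (T 2 : ℤ[T;T⁻¹]) y

/-- The properties characterizing the family `(P_{y,w})_y` for fixed `w`. -/
structure IsKLFamily (w : W) (P : W →₀ ℤ[X]) : Prop where
  bar_eq : heckeBar cs (T 2) (klCombination cs w P) = klCombination cs w P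
  eq_one : P w = 1
  eq_zero : ∀ y, ¬ cs.BruhatLT y w → y ≠ w → P y = 0
  degree_le : ∀ y, cs.BruhatLT y w → 2 * (P y).natDegree + cs.length y + 1 ≤ cs.length w

open Classical in
/-- The family `(P_{y,w})_y` of Kazhdan-Lusztig polynomials for fixed `w`: the unique family
with the properties `IsKLFamily`. -/
def klFamily (w : W) : W →₀ ℤ[X] :=
  if h : ∃ P, IsKLFamily cs w P then h.choose else 0

/-- The Kazhdan-Lusztig polynomial `P_{y,w}`, a polynomial in `q`. -/
def klP (y w : W) : ℤ[X] := klFamily cs w y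

/-- The Kazhdan-Lusztig basis element `c_w` of the Hecke algebra with parameter `q`. -/
def klc (w : W) : HeckeAlgebra cs (T 2 : ℤ[T;T⁻¹]) := klCombination cs w (klFamily cs w)

/-- The Kazhdan-Lusztig basis element `C_w = q^{-ℓ(w)} ∑_y P_{y,w}(q²) T_y` of the Hecke algebra
with parameter `q² = T 4`. -/
def klC (w : W) : HeckeAlgebra cs (T 4 : ℤ[T;T⁻¹]) :=
  (T (-2 * (cs.length w : ℤ)) : ℤ[T;T⁻¹]) •
    (klFamily cs w).sum fun y p => aeval (T 4 : ℤ[T;T⁻¹]) p •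
      HeckeAlgebra.t cs (T 4 : ℤ[T;T⁻¹]) y

/-- The coordinates of `x` with respect to a basis `e`: the finitely supported `a` with
`x = ∑_i a_i e_i`. -/
def coords {ι V : Type*} [AddCommGroup V] [Module ℤ[T;T⁻¹] V] (e : ι → V) (x : V) :
    ι →₀ ℤ[T;T⁻¹] :=
  Function.invFun (Finsupp.linearCombination ℤ[T;T⁻¹] e) x

/-- The structure constants `h_{x,y;z}`, given by `c_x c_y = ∑_z h_{x,y;z} c_z`. -/
def klH (x y : W) : W →₀ ℤ[T;T⁻¹] := coords (klc cs) (klc cs x * klc cs y)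

/-- The Laurent polynomials `f_{w,x,y;z} = ∑_g h_{w,x;g} h_{g,y;z}`. -/
def klF (w x y z : W) : ℤ[T;T⁻¹] := (klH cs w x).sum fun g a => a * klH cs g y z

end KazhdanLusztig

/-! ### Twisted involutions and the Lusztig-Vogan module -/

section Twisted

open LaurentPolynomial (T)

variable {B W : Type*} [Group W] {M : CoxeterMatrix B} {cs : CoxeterSystem M W}

/-- A group automorphism `*` of `W` of order at most two which preserves the set of simple
reflections. -/
structure CoxeterInvolution (cs : CoxeterSystem M W) where
  star : W ≃* W
  star_star : ∀ w, star (star w) = w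
  star_simple : ∀ i, ∃ j, star (cs.simple i) = cs.simple j

variable (σ : CoxeterInvolution cs)

/-- The set `I_*` of twisted involutions: the `w` with `w^* = w⁻¹`. -/
def TwInv : Type _ := {w : W // σ.star w = w⁻¹}

instance : CoeOut (TwInv σ) W := ⟨Subtype.val⟩

/-- The identity as a twisted involution. -/
def TwInv.one : TwInv σ := ⟨1, by simp⟩

open Classical in
/-- The twisted involution `s ⋉ w`: it is `sw` if `w = s w s^*`, and `s w s^*` otherwise. -/
def TwInv.act (i : B) (w : TwInv σ) : TwInv σ :=
  ⟨if cs.simple i * w.1 * σ.star (cs.simple i) = w.1 then cs.simple i * w.1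
    else cs.simple i * w.1 * σ.star (cs.simple i), by
    have hs : σ.star (cs.simple i) * σ.star (cs.simple i) = 1 := by
      rw [← map_mul]; simp
    have hw := w.2
    split_ifs with h
    · rw [map_mul, hw, mul_inv_rev, CoxeterSystem.inv_simple]
      have h2 : cs.simple i * w.1 = w.1 * σ.star (cs.simple i) := by
        calc cs.simple i * w.1
            = cs.simple i * w.1 * (σ.star (cs.simple i) * σ.star (cs.simple i)) := by
              rw [hs, mul_one]
          _ = w.1 * σ.star (cs.simple i) := by rw [← mul_assoc, h]
      have h3 := congrArg (fun x => x⁻¹) h2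
      simp only [mul_inv_rev, CoxeterSystem.inv_simple] at h3
      rw [h3, inv_eq_of_mul_eq_one_right hs]
    · rw [map_mul, map_mul, hw, σ.star_star, mul_inv_rev, mul_inv_rev, CoxeterSystem.inv_simple,
        inv_eq_of_mul_eq_one_right hs, mul_assoc]⟩

/-- The free `ℤ[v, v⁻¹]`-module `M_{q²}` with basis `a_w`, `w ∈ I_*`. -/
abbrev TwModule : Type _ := TwInv σ →₀ ℤ[T;T⁻¹]

/-- The standard basis element `a_w`. -/
def TwModule.a (w : TwInv σ) : TwModule σ := Finsupp.single w 1

open Classical in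
/-- The action of `T_s` on `M_{q²}`, given on the standard basis, with `q = T 2`, by the four cases
of the rule of Lusztig and Vogan. In the first two cases `s ⋉ w = sw`, in the last two
`s ⋉ w = s w s^*`. -/
def twSimple (i : B) : TwModule σ →ₗ[ℤ[T;T⁻¹]] TwModule σ :=
  Finsupp.linearCombination ℤ[T;T⁻¹] fun w =>
    let w' := TwInv.act σ i w
    if cs.simple i * w.1 * σ.star (cs.simple i) = w.1 then
      if cs.BruhatLT w.1 w'.1 then
        (T 2 + 1 : ℤ[T;T⁻¹]) • TwModule.a σ w' + (T 2 : ℤ[T;T⁻¹]) • TwModule.a σ w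
      else
        (T 4 - T 2 : ℤ[T;T⁻¹]) • TwModule.a σ w' +
          (T 4 - T 2 - 1 : ℤ[T;T⁻¹]) • TwModule.a σ w
    else
      if cs.BruhatLT w.1 w'.1 then TwModule.a σ w'
      else (T 4 : ℤ[T;T⁻¹]) • TwModule.a σ w' + (T 4 - 1 : ℤ[T;T⁻¹]) • TwModule.a σ w

/-- The action of the Hecke algebra with parameter `q²` on `M_{q²}`: it is linear, and the basis
element `T_w = T_{s_1} ⋯ T_{s_k}`, where `s_1 ⋯ s_k` is a reduced word of `w`, acts through
the operators of the `T_{s_i}`. -/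
def twAction : HeckeAlgebra cs (T 4 : ℤ[T;T⁻¹]) →ₗ[ℤ[T;T⁻¹]] Module.End ℤ[T;T⁻¹] (TwModule σ) :=
  (Finsupp.linearCombination ℤ[T;T⁻¹] fun w => ((cs.reducedWord w).map (twSimple σ)).prod :
    (W →₀ ℤ[T;T⁻¹]) →ₗ[ℤ[T;T⁻¹]] Module.End ℤ[T;T⁻¹] (TwModule σ))

/-- The properties characterizing the bar operator of `M_{q²}`. -/
structure IsTwBar (b : TwModule σ →+ TwModule σ) : Prop where
  involutive : ∀ m, b (b m) = m
  map_one : b (TwModule.a σ (TwInv.one σ)) = TwModule.a σ (TwInv.one σ)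
  map_act : ∀ (h : HeckeAlgebra cs (T 4 : ℤ[T;T⁻¹])) (m : TwModule σ),
    b (twAction σ h m) = twAction σ (heckeBar cs (T 4) h) (b m)

open Classical in
/-- The bar operator of `M_{q²}`: the unique additive map with the properties `IsTwBar`. -/
def twBar : TwModule σ →+ TwModule σ := if h : ∃ b, IsTwBar σ b then h.choose else 0

/-- The element `v^{-ℓ(w)} ∑_y P_y(q) a_y` of `M_{q²}`. -/
def twCombination (w : TwInv σ) (P : TwInv σ →₀ ℤ[X]) : TwModule σ :=
  (T (-(cs.length w.1 : ℤ)) : ℤ[T;T⁻¹]) •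
    P.sum fun y p => aeval (T 2 : ℤ[T;T⁻¹]) p • TwModule.a σ y

/-- The properties characterizing the family `(P^σ_{y,w})_y` for fixed `w`. -/
structure IsTwKLFamily (w : TwInv σ) (P : TwInv σ →₀ ℤ[X]) : Prop where
  bar_eq : twBar σ (twCombination σ w P) = twCombination σ w P
  eq_one : P w = 1
  eq_zero : ∀ y : TwInv σ, ¬ cs.BruhatLT y.1 w.1 → y ≠ w → P y = 0
  degree_le : ∀ y : TwInv σ, cs.BruhatLT y.1 w.1 →
    2 * (P y).natDegree + cs.length y.1 + 1 ≤ cs.length w.1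

open Classical in
/-- The family `(P^σ_{y,w})_y` of twisted Kazhdan-Lusztig polynomials for fixed `w`: the unique
family with the properties `IsTwKLFamily`. -/
def twKLFamily (w : TwInv σ) : TwInv σ →₀ ℤ[X] :=
  if h : ∃ P, IsTwKLFamily σ w P then h.choose else 0

/-- The twisted Kazhdan-Lusztig polynomial `P^σ_{y,w}`, a polynomial in `q`. -/
def twP (y w : TwInv σ) : ℤ[X] := twKLFamily σ w y

/-- The twisted Kazhdan-Lusztig basis element `A_w`. -/
def twA (w : TwInv σ) : TwModule σ := twCombination σ w (twKLFamily σ w)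

/-- The Laurent polynomials `h̃_{x,y;z}`, given by `c_x c_y c_{(x^*)⁻¹} = ∑_z h̃_{x,y;z} c_z`. -/
def klHTilde (x : W) (y : TwInv σ) : W →₀ ℤ[T;T⁻¹] :=
  coords (klc cs) (klc cs x * klc cs y.1 * klc cs (σ.star x)⁻¹)

/-- The Laurent polynomials `h^σ_{x,y;z}`, given by `C_x A_y = ∑_z h^σ_{x,y;z} A_z`. -/
def twH (x : W) (y : TwInv σ) : TwInv σ →₀ ℤ[T;T⁻¹] :=
  coords (twA σ) (twAction σ (klC cs x) (twA σ y))

/-- A polynomial with integer coefficients, viewed in `ℚ[X]`. -/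
def polyToRat : ℤ[X] →+* ℚ[X] := Polynomial.mapRingHom (Int.castRingHom ℚ)

/-- A Laurent polynomial with integer coefficients, viewed in `ℚ[T;T⁻¹]`. -/
def laurentToRat : ℤ[T;T⁻¹] →+* ℚ[T;T⁻¹] := AddMonoidAlgebra.mapRingHom ℤ (Int.castRingHom ℚ)

/-- The polynomials `P^± = (P ± P^σ) / 2` in `ℚ[q]`; the sign is `ε = ±1`. -/
def signP (ε : ℤˣ) (y w : TwInv σ) : ℚ[X] :=
  (1 / 2 : ℚ) • (polyToRat (klP cs y.1 w.1) + (ε : ℤ) • polyToRat (twP σ y w))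

/-- The Laurent polynomials `h^± = (h̃ ± h^σ) / 2` in `ℚ[v, v⁻¹]`; the sign is `ε = ±1`. -/
def signH (ε : ℤˣ) (x : W) (y z : TwInv σ) : ℚ[T;T⁻¹] :=
  (1 / 2 : ℚ) • (laurentToRat (klHTilde σ x y z.1) + (ε : ℤ) • laurentToRat (twH σ x y z))

/-- The substitution `v ↦ v²` on Laurent polynomials. -/
def laurentSq : ℤ[T;T⁻¹] →+* ℤ[T;T⁻¹] :=
  AddMonoidAlgebra.mapDomainRingHom ℤ (AddMonoidHom.mulLeft (2 : ℤ))

end Twisted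

/-- The involution `(x, y)^* = (y, x)` of the Coxeter system `(W, S) × (W, S)`. -/
def swapInvolution {B W : Type*} [Group W] {M : CoxeterMatrix B} (cs : CoxeterSystem M W) :
    CoxeterInvolution (cs.prod cs) where
  star := MulEquiv.prodComm
  star_star _ := rfl
  star_simple i := by
    rcases i with i | i
    · exact ⟨Sum.inr i, by rw [CoxeterSystem.prod_simple_inl, CoxeterSystem.prod_simple_inr]; rfl⟩
    · exact ⟨Sum.inl i, by rw [CoxeterSystem.prod_simple_inl, CoxeterSystem.prod_simple_inr]; rfl⟩

end

/-! The twisted involutions of `W' × W'` for the swap are the pairs `(w, w⁻¹)`, so `a_{(w, w⁻¹)} ↦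
T_w` identifies the module `M_{q²}` with the Hecke algebra `H_{q²}` of `W'`. Under this
identification `T_{(s,1)}` acts as left multiplication by `T_s` and `T_{(1,s)}` as right
multiplication by `T_s`: among the four cases of the module rule only those with `s ⋉ w = s w s^*`
occur. Since `a_1` generates the module, its bar operator must be that of `H_{q²}`. The length of
`(w, w⁻¹)` is `2ℓ(w)`, so `A_{(w, w⁻¹)}` corresponds to `C_w` and `P^σ` is `P_{y,w}(q²)`
(`twKLFamily_eq`).

On the untwisted side `H(W' × W')` is a tensor product, Kazhdan-Lusztig elements are products of
those of the factors (`klElement_prod`), and `t_w ↦ t_{w⁻¹}` shows `P_{y⁻¹,w⁻¹} = P_{y,w}`. Hence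
the ordinary polynomial is `P_{y,w}(q)²`.

For the structure constants, `C_x A_y` with `x = (x₁, x₂)` corresponds to `C_{x₁} C_y C_{x₂⁻¹}`, the
image of `c_{x₁} c_y c_{x₂⁻¹}` under `v ↦ v²`; its coefficients are `f(v²)` (`twH_eq`). The product
`c_x c_y c_{(x^*)⁻¹}` has `c_{x₁} c_y c_{x₂⁻¹}` as its first tensor factor and the flip of that
element as its second, which gives `f(v)²` (`klHTilde_eq`).

The families and bar operators are introduced by choice, so their existence and uniqueness are
proved along the way. One element over `ℤ[X]`, `klElement`, specializes at `X = v²` and `X = v⁴` to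
`c_w` and `C_w` up to normalization. -/

noncomputable section

namespace CoxeterSystem

/-! ### Strong exchange and the lifting property of the Bruhat order -/

section Bruhat

variable {B W : Type*} [Group W] {M : CoxeterMatrix B} (cs : CoxeterSystem M W)

theorem length_induction_left {p : W → Prop} (one : p 1)
    (mul : ∀ w i, cs.length w < cs.length (cs.simple i * w) → p w → p (cs.simple i * w)) (w : W) :
    p w := by
  induction h : cs.length w generalizing w with
  | zero => rw [cs.length_eq_zero_iff.1 h]; exact one
  | succ n ih =>
    have hne : w ≠ 1 := by rintro rfl; simp at h
    obtain ⟨i, hi⟩ := cs.exists_leftDescent_of_ne_one hne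
    have hl := cs.isLeftDescent_iff.1 hi
    have := mul (cs.simple i * w) i (by simp; omega) (ih _ (by omega))
    simpa using this

-- The parity action is multiplicative in the word: the suffix acts first and conjugates `t` before
-- the prefix sees it.
open Classical in
theorem count_rightInvSeq_append (ω ω' : List B) (t : W) :
    ((cs.rightInvSeq (ω ++ ω')).count t : ZMod 2) = (cs.rightInvSeq ω').count t +
      (cs.rightInvSeq ω).count (cs.wordProd ω' * t * (cs.wordProd ω')⁻¹) := by
  have h := cs.parityStep_prod (ω ++ ω') (t, 0)
  rw [List.map_append, List.prod_append] at h
  change (ω.map cs.parityStep).prod ((ω'.map cs.parityStep).prod (t, 0)) = _ at h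
  rw [parityStep_prod, parityStep_prod] at h
  simpa using (congrArg Prod.snd h).symm

/-- The strong exchange condition. -/
theorem mem_rightInvSeq_of_isRightInversion (ω : List B) {t : W}
    (h : cs.IsRightInversion (cs.wordProd ω) t) : t ∈ cs.rightInvSeq ω := by
  classical
  obtain ⟨ht, hlt⟩ := h
  obtain ⟨τ, hτ, hcount⟩ : ∃ τ : List B, cs.wordProd τ = t ∧
      ((cs.rightInvSeq τ).count t : ZMod 2) = 1 := by
    obtain ⟨u, i, rfl⟩ := ht
    obtain ⟨ν, -, rfl⟩ := cs.exists_isReduced u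
    refine ⟨ν ++ [i] ++ ν.reverse, by
      rw [wordProd_append, wordProd_append, wordProd_reverse, wordProd_singleton], ?_⟩
    have e : cs.wordProd ν.reverse * (cs.wordProd ν * cs.simple i * (cs.wordProd ν)⁻¹) *
        (cs.wordProd ν.reverse)⁻¹ = cs.simple i := by
      rw [wordProd_reverse]; group
    -- The word `ν ν⁻¹` represents 1, so the contributions of the two outer pieces cancel modulo 2
    -- and only the middle letter is left.
    have h0 := cs.count_rightInvSeq_append ν ν.reverse
      (cs.wordProd ν * cs.simple i * (cs.wordProd ν)⁻¹)
    rw [e, cs.count_rightInvSeq_congr (ω' := []) (by simp [wordProd_append, wordProd_reverse])] at h0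
    rw [count_rightInvSeq_append, e, count_rightInvSeq_append]
    simp only [wordProd_singleton, rightInvSeq_singleton, simple_mul_simple_self, one_mul,
      inv_simple, List.count_singleton_self]
    rw [rightInvSeq_nil, List.count_nil] at h0
    linear_combination -h0
  by_contra hn
  -- Both `ω'` followed by `τ` and `ω` represent the same element. If `t` were missing from the
  -- sequence of `ω`, it would occur oddly often in that of the reduced word `ω'`, making it an
  -- inversion of `wt`, contrary to `ℓ(wt) < ℓ(w)`.
  obtain ⟨ω', hr, hω'⟩ := cs.exists_isReduced (cs.wordProd ω * t)
  have h1 := cs.count_rightInvSeq_append ω' τ t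
  rw [cs.count_rightInvSeq_congr (ω' := ω) (by
      rw [wordProd_append, hτ, ← hω', mul_assoc, ht.mul_self, mul_one]), hcount, hτ,
    List.count_eq_zero.2 hn, mul_inv_cancel_right] at h1
  have hm : t ∈ cs.rightInvSeq ω' := by
    by_contra hn'
    rw [List.count_eq_zero.2 hn'] at h1
    simp at h1
  have h3 := (cs.isRightInversion_of_mem_rightInvSeq hr hm).2
  rw [← hω', mul_assoc, ht.mul_self, mul_one] at h3
  omega

/-- Otherwise `a⁻¹ t a` is a right inversion of `s a`. By strong exchange it is either the new first
entry of the inversion sequence, which forces `t = s`, or an inversion of `a` itself, which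
contradicts `a < t a`. -/
theorem length_simple_mul_lt_of_reflection {t a : W} {i : B} (ht : cs.IsReflection t)
    (hlt : cs.length a < cs.length (t * a)) (hne : t ≠ cs.simple i) :
    cs.length (cs.simple i * a) < cs.length (cs.simple i * (t * a)) := by
  have hr : cs.IsReflection (a⁻¹ * t * a) := by simpa using ht.conj a⁻¹
  have e : cs.simple i * (t * a) = cs.simple i * a * (a⁻¹ * t * a) := by group
  by_contra hcon
  have hlt' : cs.length (cs.simple i * a * (a⁻¹ * t * a)) < cs.length (cs.simple i * a) :=
    lt_of_le_of_ne (by rw [← e]; omega) (hr.length_mul_left_ne _)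
  have h1 := cs.length_simple_mul a i
  have h2 := cs.length_simple_mul (t * a) i
  obtain ⟨ω, hω, rfl⟩ := cs.exists_isReduced a
  have hm := cs.mem_rightInvSeq_of_isRightInversion (i :: ω) (t := (cs.wordProd ω)⁻¹ * t *
    cs.wordProd ω) ⟨hr, by rw [wordProd_cons]; exact hlt'⟩
  rw [rightInvSeq, List.mem_cons] at hm
  rcases hm with hm | hm
  · apply hne
    have := congrArg (fun x => cs.wordProd ω * x * (cs.wordProd ω)⁻¹) hm
    simpa [mul_assoc] using this
  · have := (cs.isRightInversion_of_mem_rightInvSeq hω hm).2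
    rw [show cs.wordProd ω * ((cs.wordProd ω)⁻¹ * t * cs.wordProd ω) = t * cs.wordProd ω by group]
      at this
    omega

theorem bruhatLE_refl (w : W) : cs.BruhatLE w w := Relation.ReflTransGen.refl

variable {cs} in
theorem BruhatLE.trans {x y z : W} (h : cs.BruhatLE x y) (h' : cs.BruhatLE y z) :
    cs.BruhatLE x z := Relation.ReflTransGen.trans h h'

theorem bruhatLE_simple_mul {w : W} {i : B} (h : cs.length w < cs.length (cs.simple i * w)) :
    cs.BruhatLE w (cs.simple i * w) := ((cs.bruhatLT_simple_mul_iff w i).2 h).1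

theorem BruhatLT.length_lt {cs : CoxeterSystem M W} {y w : W} (h : cs.BruhatLT y w) :
    cs.length y < cs.length w := (cs.length_le_of_bruhatLE h.1).resolve_left h.2

/-- The lifting property of the Bruhat order. -/
theorem bruhatLE_simple_mul_or {a b : W} (i : B) (h : cs.BruhatLE a b) :
    cs.BruhatLE (cs.simple i * a) b ∨ cs.BruhatLE (cs.simple i * a) (cs.simple i * b) := by
  unfold BruhatLE at h
  induction h with
  | refl => exact Or.inr (cs.bruhatLE_refl _)
  | @tail b c _ hs ih =>
    have hbc : cs.BruhatLE b c := Relation.ReflTransGen.single hs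
    rcases ih with ih | ih
    · exact Or.inl (ih.trans hbc)
    · obtain ⟨t, ht, rfl, hlt⟩ := hs
      -- A step by `s` itself turns the bound by `s b` into the first alternative; any other step
      -- survives left multiplication by `s`.
      by_cases hne : t = cs.simple i
      · subst hne
        exact Or.inl ih
      · refine Or.inr (ih.trans (Relation.ReflTransGen.single ⟨cs.simple i * t * (cs.simple i)⁻¹,
          ht.conj _, by simp [mul_assoc], ?_⟩))
        exact cs.length_simple_mul_lt_of_reflection ht hlt hne

/-- This keeps the support of `(t_s + 1) x` below `s w` when the support of `x` lies below `w`. -/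
theorem bruhatLE_simple_mul_of_simple_mul_le {y w : W} {i : B}
    (hw : cs.length w < cs.length (cs.simple i * w)) (h : cs.BruhatLE (cs.simple i * y) w) :
    cs.BruhatLE y (cs.simple i * w) := by
  have := cs.bruhatLE_simple_mul_or i h
  rw [simple_mul_simple_cancel_left] at this
  exact this.elim (fun h => h.trans (cs.bruhatLE_simple_mul hw)) id

theorem BruhatLE.inv {cs : CoxeterSystem M W} {y w : W} (h : cs.BruhatLE y w) :
    cs.BruhatLE y⁻¹ w⁻¹ := by
  unfold BruhatLE at h
  induction h with
  | refl => exact cs.bruhatLE_refl _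
  | @tail b c _ hs ih =>
    obtain ⟨t, ht, rfl, hlt⟩ := hs
    refine ih.trans (Relation.ReflTransGen.single ⟨b⁻¹ * t * b, by simpa using ht.conj b⁻¹, ?_, ?_⟩)
    · rw [mul_inv_rev, ht.inv]; group
    · rwa [length_inv, length_inv]

theorem bruhatLE_inv_iff {y w : W} : cs.BruhatLE y⁻¹ w⁻¹ ↔ cs.BruhatLE y w :=
  ⟨fun h => by simpa using h.inv, BruhatLE.inv⟩

end Bruhat

/-! ### Length and Bruhat order of a product -/

section Prod

variable {B B' W W' : Type*} [Group W] [Group W'] {M : CoxeterMatrix B} {M' : CoxeterMatrix B'}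
variable (cs : CoxeterSystem M W) (cs' : CoxeterSystem M' W')

theorem prod_wordProd (ω : List (B ⊕ B')) : (cs.prod cs').wordProd ω =
    (cs.wordProd (ω.filterMap Sum.getLeft?), cs'.wordProd (ω.filterMap Sum.getRight?)) := by
  induction ω with
  | nil => simp only [wordProd_nil, List.filterMap_nil]; rfl
  | cons i ω ih =>
    rw [wordProd_cons, ih]
    rcases i with i | i
    · simp [prod_simple_inl, wordProd_cons, List.filterMap_cons]
    · simp [prod_simple_inr, wordProd_cons, List.filterMap_cons]

/-- Concatenating reduced words of the coordinates bounds the length from above; sorting the letters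
of a word by factor bounds it from below. -/
theorem prod_length (w : W × W') :
    (cs.prod cs').length w = cs.length w.1 + cs'.length w.2 := by
  apply le_antisymm
  · obtain ⟨ω, hω, h1⟩ := cs.exists_isReduced w.1
    obtain ⟨ω', hω', h2⟩ := cs'.exists_isReduced w.2
    have e : (cs.prod cs').wordProd (ω.map Sum.inl ++ ω'.map Sum.inr) = w := by
      rw [prod_wordProd]
      have a1 : (ω.map Sum.inl ++ ω'.map Sum.inr : List (B ⊕ B')).filterMap Sum.getLeft? = ω := by
        simp [List.filterMap_map, Function.comp_def]
      have a2 : (ω.map Sum.inl ++ ω'.map Sum.inr : List (B ⊕ B')).filterMap Sum.getRight? = ω' := by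
        simp [List.filterMap_map, Function.comp_def]
      rw [a1, a2, ← h1, ← h2]
    have := (cs.prod cs').length_wordProd_le (ω.map Sum.inl ++ ω'.map Sum.inr)
    rw [e, List.length_append, List.length_map, List.length_map] at this
    rwa [h1, h2, hω.eq, hω'.eq]
  · obtain ⟨ω, hω, rfl⟩ := (cs.prod cs').exists_isReduced w
    rw [hω.eq, prod_wordProd]
    refine (add_le_add (cs.length_wordProd_le _) (cs'.length_wordProd_le _)).trans (le_of_eq ?_)
    clear hω
    induction ω with
    | nil => simp
    | cons i ω ih => rcases i with i | i <;> simp [List.filterMap_cons] <;> omega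

theorem isReflection_prod {t : W × W'} (ht : (cs.prod cs').IsReflection t) :
    (cs.IsReflection t.1 ∧ t.2 = 1) ∨ (t.1 = 1 ∧ cs'.IsReflection t.2) := by
  obtain ⟨w, i, rfl⟩ := ht
  rcases i with i | i
  · rw [prod_simple_inl]
    exact Or.inl ⟨⟨w.1, i, rfl⟩, by simp⟩
  · rw [prod_simple_inr]
    exact Or.inr ⟨by simp, ⟨w.2, i, rfl⟩⟩

/-- Every reflection of the product lies in one factor, so each step of a chain moves a single
coordinate. Conversely, two chains are run one after the other. -/
theorem prod_bruhatLE {y w : W × W'} :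
    (cs.prod cs').BruhatLE y w ↔ cs.BruhatLE y.1 w.1 ∧ cs'.BruhatLE y.2 w.2 := by
  constructor
  · intro h
    unfold BruhatLE at h
    induction h with
    | refl => exact ⟨cs.bruhatLE_refl _, cs'.bruhatLE_refl _⟩
    | @tail b c _ hs ih =>
      obtain ⟨t, ht, rfl, hlt⟩ := hs
      rw [prod_length, prod_length] at hlt
      rcases cs.isReflection_prod cs' ht with ⟨h1, h2⟩ | ⟨h1, h2⟩
      · simp only [Prod.fst_mul, Prod.snd_mul, h2, one_mul] at hlt ⊢
        exact ⟨ih.1.trans (Relation.ReflTransGen.single ⟨t.1, h1, rfl, by omega⟩), ih.2⟩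
      · simp only [Prod.fst_mul, Prod.snd_mul, h1, one_mul] at hlt ⊢
        exact ⟨ih.1, ih.2.trans (Relation.ReflTransGen.single ⟨t.2, h2, rfl, by omega⟩)⟩
  · rintro ⟨h1, h2⟩
    have a1 : (cs.prod cs').BruhatLE (y.1, y.2) (w.1, y.2) := by
      unfold BruhatLE at h1 ⊢
      refine Relation.ReflTransGen.lift (fun a => (a, y.2)) ?_ _ _ h1
      rintro a b ⟨t, ⟨u, i, rfl⟩, rfl, hlt⟩
      refine ⟨_, ⟨(u, 1), Sum.inl i, rfl⟩, by simp [prod_simple_inl], ?_⟩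
      rw [prod_length, prod_length]
      exact Nat.add_lt_add_right hlt _
    have a2 : (cs.prod cs').BruhatLE (w.1, y.2) (w.1, w.2) := by
      unfold BruhatLE at h2 ⊢
      refine Relation.ReflTransGen.lift (fun a => (w.1, a)) ?_ _ _ h2
      rintro a b ⟨t, ⟨u, i, rfl⟩, rfl, hlt⟩
      refine ⟨_, ⟨(1, u), Sum.inr i, rfl⟩, by simp [prod_simple_inr], ?_⟩
      rw [prod_length, prod_length]
      exact Nat.add_lt_add_left hlt _
    exact a1.trans a2

end Prod

end CoxeterSystem

/-! ### Ring inverses and Hecke algebras over a general ground ring -/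

theorem RingHom.map_ringInverse_of_isUnit {A A' : Type*} [Ring A] [Ring A'] (f : A →+* A') {a : A}
    (ha : IsUnit a) : f (Ring.inverse a) = Ring.inverse (f a) := by
  obtain ⟨a, rfl⟩ := ha
  rw [Ring.inverse_unit]
  exact (Ring.inverse_unit (Units.map (f : A →* A') a)).symm

theorem Ring.inverse_eq_of_mul_eq_one {A : Type*} [Ring A] {a b : A} (h : a * b = 1)
    (h' : b * a = 1) : Ring.inverse a = b := Ring.inverse_unit ⟨a, b, h, h'⟩

namespace HeckeAlgebra

section General

variable {B W : Type*} [Group W] {M : CoxeterMatrix B} {R : Type*} [CommRing R]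
variable (cs : CoxeterSystem M W) (u : R)

/-- The standard basis `t_w`. -/
def basis : Module.Basis W R (HeckeAlgebra cs u) :=
  .ofRepr (LinearEquiv.refl R (W →₀ R) : HeckeAlgebra cs u ≃ₗ[R] (W →₀ R))

@[simp]
theorem basis_apply (w : W) : basis cs u w = t cs u w := rfl

@[simp]
theorem repr_t (w : W) : (basis cs u).repr (t cs u w) = Finsupp.single w 1 := rfl

variable {cs u} in
theorem induction {p : HeckeAlgebra cs u → Prop} (zero : p 0)
    (add : ∀ x y, p x → p y → p (x + y)) (smul : ∀ (r : R) w, p (r • t cs u w))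
    (x : HeckeAlgebra cs u) : p x := by
  have h := (basis cs u).linearCombination_repr x
  rw [← h]
  generalize (basis cs u).repr x = a
  induction a using Finsupp.induction_linear with
  | zero => rw [map_zero]; exact zero
  | add a b ha hb => rw [map_add]; exact add _ _ ha hb
  | single w r => rw [Finsupp.linearCombination_single]; exact smul r w

theorem t_one : t cs u 1 = 1 := rfl

theorem simple_mul_t_of_lt {i : B} {w : W} (h : cs.length w < cs.length (cs.simple i * w)) :
    t cs u (cs.simple i) * t cs u w = t cs u (cs.simple i * w) := by
  rw [t_simple_mul_t, if_pos ((cs.bruhatLT_simple_mul_iff w i).2 h)]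

theorem simple_mul_t_of_not_lt {i : B} {w : W}
    (h : ¬ cs.length w < cs.length (cs.simple i * w)) :
    t cs u (cs.simple i) * t cs u w = u • t cs u (cs.simple i * w) + (u - 1) • t cs u w := by
  rw [t_simple_mul_t, if_neg (fun h' => h ((cs.bruhatLT_simple_mul_iff w i).1 h'))]

/-- Left multiplication by `x` commutes with `heckeRight`; evaluating both composites at `t_1` gives
the formula. -/
theorem mul_t_simple (x : HeckeAlgebra cs u) (i : B) :
    x * t cs u (cs.simple i) = heckeRight cs u i x := by
  have h1 : heckeRight cs u i (Finsupp.single 1 1) = Finsupp.single (cs.simple i) 1 := by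
    rw [heckeRight_single, if_pos (by simp), one_mul]
  have h2 := DFunLike.congr_fun (heckeLmul_commute cs u x i).eq (Finsupp.single (1 : W) (1 : R))
  simp only [Module.End.mul_apply] at h2
  rw [h1] at h2
  exact h2.trans (congrArg (heckeRight cs u i) (heckeLmul_one cs u x))

theorem t_mul_simple_of_lt {i : B} {w : W} (h : cs.length w < cs.length (w * cs.simple i)) :
    t cs u w * t cs u (cs.simple i) = t cs u (w * cs.simple i) := by
  rw [mul_t_simple]
  exact (heckeRight_single cs u i w).trans (if_pos h)

theorem t_mul_simple_of_not_lt {i : B} {w : W}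
    (h : ¬ cs.length w < cs.length (w * cs.simple i)) :
    t cs u w * t cs u (cs.simple i) = u • t cs u (w * cs.simple i) + (u - 1) • t cs u w := by
  rw [mul_t_simple]
  exact (heckeRight_single cs u i w).trans (if_neg h)

theorem t_simple_sq (i : B) : t cs u (cs.simple i) * t cs u (cs.simple i) =
    algebraMap R _ u + (u - 1) • t cs u (cs.simple i) := by
  rw [simple_mul_t_of_not_lt cs u (by simp), cs.simple_mul_simple_self, Algebra.algebraMap_eq_smul_one]
  rfl

open Classical in
theorem repr_simple_mul (i : B) (x : HeckeAlgebra cs u) (y : W) :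
    (basis cs u).repr (t cs u (cs.simple i) * x) y =
      if cs.length (cs.simple i * y) < cs.length y then
        (basis cs u).repr x (cs.simple i * y) + (u - 1) * (basis cs u).repr x y
      else u * (basis cs u).repr x (cs.simple i * y) := by
  induction x using induction with
  | zero => simp
  | add a b ha hb =>
    rw [mul_add, map_add, Finsupp.add_apply, ha, hb, map_add]
    split_ifs <;> simp only [Finsupp.add_apply] <;> ring
  | smul r w =>
    have e1 : (w = cs.simple i * y) = (cs.simple i * w = y) := by
      apply propext
      constructor
      · rintro rfl; simp
      · rintro rfl; simp
    have hne : ∀ v, cs.simple i * v ≠ v := fun v h => cs.length_simple_mul_ne v i (by rw [h])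
    rw [mul_smul_comm]
    by_cases h : cs.length w < cs.length (cs.simple i * w)
    · rw [simple_mul_t_of_lt cs u h]
      simp only [map_smul, repr_t, Finsupp.smul_apply, Finsupp.single_apply, e1]
      by_cases hy : cs.simple i * w = y
      · subst hy
        have h3 := hne w
        simp [h, Ne.symm h3]
      · by_cases hy2 : w = y
        · subst hy2
          simp [hy, not_lt_of_gt h]
        · simp [hy, hy2]
    · rw [simple_mul_t_of_not_lt cs u h]
      have h' := lt_of_le_of_ne (not_lt.1 h) (cs.length_simple_mul_ne w i)
      simp only [map_smul, map_add, repr_t, Finsupp.smul_apply, Finsupp.add_apply,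
        Finsupp.single_apply, e1]
      by_cases hy : cs.simple i * w = y
      · subst hy
        have h3 := hne w
        simp [not_lt_of_gt h', Ne.symm h3, mul_comm]
      · by_cases hy2 : w = y
        · subst hy2
          simp [hy, h', mul_comm]
        · simp [hy, hy2]

/-- An additive map out of the Hecke algebra which is semilinear and compatible with left
multiplication of the `t_w` by the `t_s` is multiplicative. -/
theorem map_mul_of_simple {cs : CoxeterSystem M W} {u : R} {A : Type*} [Ring A]
    (f : HeckeAlgebra cs u →+ A) (g : R →+* A)
    (hc : ∀ r x, Commute (g r) (f x)) (hsmul : ∀ r x, f (r • x) = g r * f x)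
    (h1 : f 1 = 1)
    (hs : ∀ i w, f (t cs u (cs.simple i) * t cs u w) = f (t cs u (cs.simple i)) * f (t cs u w))
    (x y : HeckeAlgebra cs u) : f (x * y) = f x * f y := by
  have hs' : ∀ i (x : HeckeAlgebra cs u),
      f (t cs u (cs.simple i) * x) = f (t cs u (cs.simple i)) * f x := by
    intro i x
    induction x using induction with
    | zero => simp
    | add a b ha hb => rw [mul_add, map_add, map_add, mul_add, ha, hb]
    | smul r w =>
      rw [mul_smul_comm, hsmul, hsmul, hs, ← mul_assoc, ← mul_assoc, (hc r _).eq]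
  have ht : ∀ w (x : HeckeAlgebra cs u), f (t cs u w * x) = f (t cs u w) * f x := by
    intro w
    induction w using cs.length_induction_left with
    | one => intro x; rw [t_one, one_mul, h1, one_mul]
    | mul w i hl ih =>
      intro x
      rw [← simple_mul_t_of_lt cs u hl, mul_assoc, hs', hs', ih, mul_assoc]
  induction x using induction with
  | zero => simp
  | add a b ha hb => rw [add_mul, map_add, map_add, add_mul, ha, hb]
  | smul r w => rw [smul_mul_assoc, hsmul, hsmul, ht, mul_assoc]

/-- Change of the ground ring. -/
def baseChange {S : Type*} [CommRing S] {u : R} {u' : S} (φ : R →+* S) (hu : φ u = u') :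
    HeckeAlgebra cs u →+* HeckeAlgebra cs u' :=
  let f : HeckeAlgebra cs u →+ HeckeAlgebra cs u' :=
    (Finsupp.mapRange.addMonoidHom φ.toAddMonoidHom : (W →₀ R) →+ (W →₀ S))
  have hsmul : ∀ (r : R) x, f (r • x) = φ r • f x := fun r x =>
    Finsupp.ext fun w => map_mul φ _ _
  have ht : ∀ w, f (t cs u w) = t cs u' w := fun w =>
    (Finsupp.mapRange_single (hf := map_zero φ)).trans (by rw [map_one]; rfl)
  { f with
    map_one' := ht 1
    map_zero' := map_zero f
    map_mul' := map_mul_of_simple f ((algebraMap S _).comp φ)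
      (fun r x => Algebra.commutes _ _)
      (fun r x => by rw [hsmul, Algebra.smul_def]; rfl)
      (ht 1)
      (fun i w => by
        rw [ht, ht]
        by_cases h : cs.length w < cs.length (cs.simple i * w)
        · rw [simple_mul_t_of_lt cs u h, simple_mul_t_of_lt cs u' h, ht]
        · rw [simple_mul_t_of_not_lt cs u h, simple_mul_t_of_not_lt cs u' h, map_add, hsmul, hsmul,
            ht, ht, map_sub, hu, map_one]) }

section

variable {S : Type*} [CommRing S] {u} {u' : S} (φ : R →+* S) (hu : φ u = u')

theorem baseChange_t (w : W) : baseChange cs φ hu (t cs u w) = t cs u' w :=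
  (Finsupp.mapRange_single (hf := map_zero φ)).trans (by rw [map_one]; rfl)

theorem baseChange_smul (r : R) (x : HeckeAlgebra cs u) :
    baseChange cs φ hu (r • x) = φ r • baseChange cs φ hu x :=
  Finsupp.ext fun _ => map_mul φ _ _

theorem repr_baseChange (x : HeckeAlgebra cs u) (w : W) :
    (basis cs u').repr (baseChange cs φ hu x) w = φ ((basis cs u).repr x w) := rfl

end

/-- The anti-automorphism `t_w ↦ t_{w⁻¹}`. -/
def flip : HeckeAlgebra cs u →ₗ[R] HeckeAlgebra cs u :=
  (basis cs u).constr R fun w => t cs u w⁻¹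

@[simp]
theorem flip_t (w : W) : flip cs u (t cs u w) = t cs u w⁻¹ :=
  (basis cs u).constr_basis R _ w

@[simp]
theorem flip_one : flip cs u 1 = 1 := by rw [← t_one, flip_t, inv_one]

/-- Viewed as a map into the opposite ring, `flip` falls under `map_mul_of_simple`; the condition on
generators becomes the rule for right multiplication by `t_s`. -/
theorem flip_mul (x y : HeckeAlgebra cs u) : flip cs u (x * y) = flip cs u y * flip cs u x := by
  have := map_mul_of_simple (A := (HeckeAlgebra cs u)ᵐᵒᵖ)
    ((MulOpposite.opAddEquiv : HeckeAlgebra cs u ≃+ _).toAddMonoidHom.comp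
      (flip cs u).toAddMonoidHom) (algebraMap R _) (fun r x => Algebra.commutes _ _)
    (fun r x => by
      rw [← Algebra.smul_def]
      exact congrArg MulOpposite.op (map_smul (flip cs u) r x))
    (congrArg MulOpposite.op (flip_one cs u))
    (fun i w => by
      refine congrArg MulOpposite.op (?_ : flip cs u _ = flip cs u _ * flip cs u _)
      rw [flip_t, flip_t, cs.inv_simple]
      have e : w⁻¹ * cs.simple i = (cs.simple i * w)⁻¹ := by simp
      by_cases h : cs.length w < cs.length (cs.simple i * w)
      · rw [simple_mul_t_of_lt cs u h, flip_t, t_mul_simple_of_lt cs u, e]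
        rwa [e, cs.length_inv, cs.length_inv]
      · rw [simple_mul_t_of_not_lt cs u h, map_add, map_smul, map_smul, flip_t, flip_t,
          t_mul_simple_of_not_lt cs u, e]
        rwa [e, cs.length_inv, cs.length_inv]) x y
  exact MulOpposite.op_injective this

theorem repr_flip (x : HeckeAlgebra cs u) (w : W) :
    (basis cs u).repr (flip cs u x) w = (basis cs u).repr x w⁻¹ := by
  classical
  induction x using induction with
  | zero => simp
  | add a b ha hb => simp only [map_add, Finsupp.add_apply, ha, hb]
  | smul r v => simp [Finsupp.single_apply, inv_eq_iff_eq_inv]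

/-- The span of the `t_w` with `ℓ(w) < k`. -/
def lengthLT (k : ℕ) : Submodule R (HeckeAlgebra cs u) :=
  Submodule.span R (t cs u '' {w | cs.length w < k})

variable {cs u}

theorem t_mem_lengthLT {w : W} {k : ℕ} (h : cs.length w < k) : t cs u w ∈ lengthLT cs u k :=
  Submodule.subset_span ⟨w, h, rfl⟩

theorem lengthLT_mono {k l : ℕ} (h : k ≤ l) : lengthLT cs u k ≤ lengthLT cs u l :=
  Submodule.span_mono (Set.image_mono fun _ hw => lt_of_lt_of_le hw h)

theorem mem_lengthLT_iff {k : ℕ} {x : HeckeAlgebra cs u} :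
    x ∈ lengthLT cs u k ↔ ∀ w, k ≤ cs.length w → (basis cs u).repr x w = 0 := by
  have := (basis cs u).mem_span_image (m := x) (s := {w | cs.length w < k})
  refine (this.trans ⟨fun h w hw => ?_, fun h w hw => ?_⟩)
  · by_contra h0
    exact absurd (h (Finsupp.mem_support_iff.2 h0)) (not_lt.2 hw)
  · by_contra h0
    exact Finsupp.mem_support_iff.1 hw (h w (not_lt.1 h0))

theorem exists_mem_lengthLT (x : HeckeAlgebra cs u) : ∃ k, x ∈ lengthLT cs u k := by
  induction x using induction with
  | zero => exact ⟨0, zero_mem _⟩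
  | add a b ha hb =>
    obtain ⟨k, hk⟩ := ha
    obtain ⟨l, hl⟩ := hb
    exact ⟨max k l, add_mem (lengthLT_mono (le_max_left _ _) hk) (lengthLT_mono (le_max_right _ _) hl)⟩
  | smul r w => exact ⟨_, Submodule.smul_mem _ r (t_mem_lengthLT (Nat.lt_succ_self _))⟩

theorem eq_zero_of_mem_lengthLT_zero {x : HeckeAlgebra cs u} (h : x ∈ lengthLT cs u 0) : x = 0 :=
  (basis cs u).repr.injective (Finsupp.ext fun w => by
    rw [mem_lengthLT_iff.1 h w (Nat.zero_le _)]; simp)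

/-- An operator which is unitriangular with respect to the length is bijective. -/
theorem bijective_of_unitriangular (L : HeckeAlgebra cs u →ₗ[R] HeckeAlgebra cs u)
    (h : ∀ w, L (t cs u w) - t cs u w ∈ lengthLT cs u (cs.length w)) : Function.Bijective L := by
  -- `L - id` lowers the length filtration by one, so injectivity and surjectivity both follow by
  -- induction on the filtration degree.
  have hN : ∀ k x, x ∈ lengthLT cs u (k + 1) → L x - x ∈ lengthLT cs u k := by
    intro k x hx
    induction hx using Submodule.span_induction with
    | mem x hx =>
      obtain ⟨w, hw, rfl⟩ := hx
      exact lengthLT_mono (Nat.le_of_lt_succ hw) (h w)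
    | zero => simp
    | add x y _ _ hx hy =>
      rw [map_add, add_sub_add_comm]
      exact add_mem hx hy
    | smul r x _ hx =>
      rw [map_smul, ← smul_sub]
      exact Submodule.smul_mem _ _ hx
  constructor
  · rw [injective_iff_map_eq_zero]
    intro x hx
    obtain ⟨k, hk⟩ := exists_mem_lengthLT x
    induction k with
    | zero => exact eq_zero_of_mem_lengthLT_zero hk
    | succ k ih =>
      apply ih
      have := hN k x hk
      rw [hx, zero_sub] at this
      exact neg_mem_iff.1 this
  · intro x
    change x ∈ LinearMap.range L
    obtain ⟨k, hk⟩ := exists_mem_lengthLT x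
    induction k generalizing x with
    | zero => rw [eq_zero_of_mem_lengthLT_zero hk]; exact zero_mem _
    | succ k ih =>
      have h1 := ih _ (hN k x hk)
      have h2 : L x ∈ LinearMap.range L := ⟨x, rfl⟩
      simpa using sub_mem h2 h1

/-- A family which is triangular with respect to the length, with units on the diagonal, is a
basis. -/
def triangularBasis (c : W → Rˣ) (e : W → HeckeAlgebra cs u)
    (h : ∀ w, c w • e w - t cs u w ∈ lengthLT cs u (cs.length w)) :
    Module.Basis W R (HeckeAlgebra cs u) :=
  ((basis cs u).map (LinearEquiv.ofBijective ((basis cs u).constr R fun w => c w • e w)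
    (bijective_of_unitriangular _ fun w => by
      have := (basis cs u).constr_basis R (fun w => c w • e w) w
      rw [basis_apply] at this
      rw [this]; exact h w))).unitsSMul fun w => (c w)⁻¹

theorem triangularBasis_apply (c : W → Rˣ) (e : W → HeckeAlgebra cs u)
    (h : ∀ w, c w • e w - t cs u w ∈ lengthLT cs u (cs.length w)) (w : W) :
    triangularBasis c e h w = e w := by
  have := (basis cs u).constr_basis R (fun w => c w • e w) w
  rw [triangularBasis, Module.Basis.unitsSMul_apply, Module.Basis.map_apply,
    LinearEquiv.ofBijective_apply, this, inv_smul_smul]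

end General

/-! ### The bar operator -/

section Bar

open LaurentPolynomial (T)

variable {B W : Type*} [Group W] {M : CoxeterMatrix B} (cs : CoxeterSystem M W) (n : ℤ)

theorem T_smul_T_smul {V : Type*} [AddCommGroup V] [Module ℤ[T;T⁻¹] V] (a b : ℤ) (x : V) :
    (T a : ℤ[T;T⁻¹]) • (T b : ℤ[T;T⁻¹]) • x = (T (a + b) : ℤ[T;T⁻¹]) • x := by
  rw [smul_smul, LaurentPolynomial.T_add]

/-- The inverse of `t_s`. -/
def tInv (i : B) : HeckeAlgebra cs (T n : ℤ[T;T⁻¹]) :=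
  (T (-n) : ℤ[T;T⁻¹]) • t cs (T n) (cs.simple i) + (T (-n) - 1 : ℤ[T;T⁻¹]) • 1

theorem t_mul_tInv (i : B) : t cs (T n : ℤ[T;T⁻¹]) (cs.simple i) * tInv cs n i = 1 := by
  rw [tInv, mul_add, mul_smul_comm, mul_smul_comm, mul_one, t_simple_sq,
    Algebra.algebraMap_eq_smul_one]
  have : (T (-n) * T n : ℤ[T;T⁻¹]) = 1 := by
    rw [← LaurentPolynomial.T_add]; simp
  rw [smul_add, smul_smul, smul_smul, mul_sub, this, add_assoc, ← add_smul]
  simp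

theorem tInv_mul_t (i : B) : tInv cs n i * t cs (T n : ℤ[T;T⁻¹]) (cs.simple i) = 1 := by
  rw [← t_mul_tInv cs n i, tInv, mul_add, add_mul, mul_smul_comm, mul_smul_comm, smul_mul_assoc,
    smul_mul_assoc, one_mul, mul_one]

theorem isUnit_t_simple (i : B) : IsUnit (t cs (T n : ℤ[T;T⁻¹]) (cs.simple i)) :=
  ⟨⟨_, _, t_mul_tInv cs n i, tInv_mul_t cs n i⟩, rfl⟩

theorem inverse_t_simple (i : B) : Ring.inverse (t cs (T n : ℤ[T;T⁻¹]) (cs.simple i)) =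
    tInv cs n i :=
  Ring.inverse_eq_of_mul_eq_one (t_mul_tInv cs n i) (tInv_mul_t cs n i)

theorem isUnit_t (w : W) : IsUnit (t cs (T n : ℤ[T;T⁻¹]) w) := by
  induction w using cs.length_induction_left with
  | one => rw [t_one]; exact isUnit_one
  | mul w i hl ih =>
    rw [← simple_mul_t_of_lt cs _ hl]
    exact (isUnit_t_simple cs n i).mul ih

/-- `heckeBar` as an additive map. -/
def barAddHom : HeckeAlgebra cs (T n : ℤ[T;T⁻¹]) →+ HeckeAlgebra cs (T n : ℤ[T;T⁻¹]) :=
  (Finsupp.liftAddHom fun w =>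
    ((AddMonoidHom.flip (AddMonoidHom.smul (R := ℤ[T;T⁻¹]) (M := HeckeAlgebra cs (T n : ℤ[T;T⁻¹]))))
      (Ring.inverse (t cs (T n) w⁻¹))).comp
      (LaurentPolynomial.invert : ℤ[T;T⁻¹] ≃ₐ[ℤ] ℤ[T;T⁻¹]).toRingHom.toAddMonoidHom :
      (W →₀ ℤ[T;T⁻¹]) →+ HeckeAlgebra cs (T n : ℤ[T;T⁻¹]))

theorem barAddHom_smul_t (r : ℤ[T;T⁻¹]) (w : W) : barAddHom cs n (r • t cs (T n) w) =
    LaurentPolynomial.invert r • Ring.inverse (t cs (T n) w⁻¹) := by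
  have e : (r • t cs (T n : ℤ[T;T⁻¹]) w : HeckeAlgebra cs (T n : ℤ[T;T⁻¹])) =
      (Finsupp.single w r : W →₀ ℤ[T;T⁻¹]) := by
    rw [← Finsupp.smul_single_one]; rfl
  rw [e]
  refine (Finsupp.liftAddHom_apply_single _ w r).trans ?_
  rfl

theorem barAddHom_smul (r : ℤ[T;T⁻¹]) (x : HeckeAlgebra cs (T n : ℤ[T;T⁻¹])) :
    barAddHom cs n (r • x) = LaurentPolynomial.invert r • barAddHom cs n x := by
  induction x using induction with
  | zero => simp
  | add a b ha hb => rw [smul_add, map_add, map_add, smul_add, ha, hb]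
  | smul s w => rw [smul_smul, barAddHom_smul_t, barAddHom_smul_t, map_mul, smul_smul]

theorem barAddHom_t (w : W) : barAddHom cs n (t cs (T n) w) = Ring.inverse (t cs (T n) w⁻¹) := by
  have := barAddHom_smul_t cs n 1 w
  rwa [one_smul, map_one, one_smul] at this

theorem inverse_t_simple_mul {w : W} {i : B} (h : cs.length w < cs.length (cs.simple i * w)) :
    Ring.inverse (t cs (T n : ℤ[T;T⁻¹]) (cs.simple i * w)⁻¹) =
      tInv cs n i * Ring.inverse (t cs (T n) w⁻¹) := by
  rw [mul_inv_rev, cs.inv_simple, ← t_mul_simple_of_lt cs _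
    (by rwa [← cs.length_inv, ← cs.length_inv (_ * _), mul_inv_rev, inv_inv, cs.inv_simple]),
    Ring.inverse_mul (Or.inl (isUnit_t cs n _)), inverse_t_simple]

/-- The bar operator as a ring homomorphism. -/
def bar : HeckeAlgebra cs (T n : ℤ[T;T⁻¹]) →+* HeckeAlgebra cs (T n : ℤ[T;T⁻¹]) :=
  have h1 : barAddHom cs n 1 = 1 := by
    rw [← t_one, barAddHom_t, inv_one, t_one, Ring.inverse_one]
  { barAddHom cs n with
    map_one' := h1
    map_zero' := map_zero (barAddHom cs n)
    map_mul' := map_mul_of_simple (barAddHom cs n)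
      ((algebraMap ℤ[T;T⁻¹] _).comp (LaurentPolynomial.invert : ℤ[T;T⁻¹] ≃ₐ[ℤ] ℤ[T;T⁻¹]).toRingHom)
      (fun r x => Algebra.commutes _ _)
      (fun r x => by rw [barAddHom_smul, Algebra.smul_def]; rfl)
      h1
      (fun i w => by
        rw [barAddHom_t, cs.inv_simple, inverse_t_simple, barAddHom_t]
        by_cases h : cs.length w < cs.length (cs.simple i * w)
        · rw [simple_mul_t_of_lt cs _ h, barAddHom_t, inverse_t_simple_mul cs n h]
        · obtain ⟨v, rfl⟩ : ∃ v, w = cs.simple i * v := ⟨cs.simple i * w, by simp⟩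
          have hv : cs.length v < cs.length (cs.simple i * v) := by
            rw [cs.simple_mul_simple_cancel_left] at h
            exact lt_of_le_of_ne (not_lt.1 h) (cs.length_simple_mul_ne v i).symm
          rw [simple_mul_t_of_not_lt cs _ h, map_add, barAddHom_smul, barAddHom_smul,
            cs.simple_mul_simple_cancel_left, barAddHom_t, barAddHom_t,
            inverse_t_simple_mul cs n hv, ← mul_assoc, map_sub, map_one,
            LaurentPolynomial.invert_T]
          -- Expanding one factor of `t_s⁻²` produces the quadratic relation of `t_s⁻¹`, which is
          -- what the case `s w < w` requires.
          nth_rewrite 2 [tInv]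
          rw [add_mul, smul_mul_assoc, t_mul_tInv, smul_mul_assoc, one_mul, add_mul,
            smul_mul_assoc, smul_mul_assoc, one_mul]) }

theorem bar_apply (x : HeckeAlgebra cs (T n : ℤ[T;T⁻¹])) : bar cs n x = heckeBar cs (T n) x := rfl

theorem bar_smul (r : ℤ[T;T⁻¹]) (x : HeckeAlgebra cs (T n : ℤ[T;T⁻¹])) :
    bar cs n (r • x) = LaurentPolynomial.invert r • bar cs n x := barAddHom_smul cs n r x

theorem bar_t (w : W) : bar cs n (t cs (T n) w) = Ring.inverse (t cs (T n) w⁻¹) :=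
  barAddHom_t cs n w

theorem bar_t_simple (i : B) : bar cs n (t cs (T n) (cs.simple i)) = tInv cs n i := by
  rw [bar_t, cs.inv_simple, inverse_t_simple]

theorem bar_bar (x : HeckeAlgebra cs (T n : ℤ[T;T⁻¹])) : bar cs n (bar cs n x) = x := by
  induction x using induction with
  | zero => simp
  | add a b ha hb => rw [map_add, map_add, ha, hb]
  | smul r w =>
    rw [bar_smul, bar_smul, LaurentPolynomial.involutive_invert, bar_t,
      RingHom.map_ringInverse_of_isUnit _ (isUnit_t cs n _), bar_t, inv_inv]
    obtain ⟨a, ha⟩ := isUnit_t cs n w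
    rw [← ha, Ring.inverse_unit, Ring.inverse_unit, inv_inv]

theorem flip_inverse {a : HeckeAlgebra cs (T n : ℤ[T;T⁻¹])} (ha : IsUnit a) :
    flip cs (T n) (Ring.inverse a) = Ring.inverse (flip cs (T n) a) := by
  obtain ⟨a, rfl⟩ := ha
  rw [Ring.inverse_unit]
  refine (Ring.inverse_eq_of_mul_eq_one ?_ ?_).symm
  · rw [← flip_mul, a.inv_mul, flip_one]
  · rw [← flip_mul, a.mul_inv, flip_one]

theorem bar_flip (x : HeckeAlgebra cs (T n : ℤ[T;T⁻¹])) :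
    bar cs n (flip cs (T n) x) = flip cs (T n) (bar cs n x) := by
  induction x using induction with
  | zero => simp
  | add a b ha hb => simp only [map_add, ha, hb]
  | smul r w =>
    rw [bar_smul, map_smul (flip cs (T n)), map_smul (flip cs (T n)), bar_smul, bar_t, flip_t,
      bar_t, flip_inverse cs n (isUnit_t cs n _), flip_t]

/-- The bar operator is triangular for the length: each left factor `t_s⁻¹` raises the length by at
most one, and its coefficient at `t_s` is `v^{-n}`, which accumulates to the diagonal entry
`v^{-nℓ(w)}`. -/
theorem bar_t_sub_mem (w : W) : bar cs n (t cs (T n) w) -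
    (T (-(n * cs.length w)) : ℤ[T;T⁻¹]) • t cs (T n) w ∈ lengthLT cs (T n) (cs.length w) := by
  induction w using cs.length_induction_left with
  | one => simp [t_one]
  | mul w i hl ih =>
    have hl' : cs.length (cs.simple i * w) = cs.length w + 1 := by
      have := cs.length_simple_mul w i; omega
    have hmul : ∀ x ∈ lengthLT cs (T n : ℤ[T;T⁻¹]) (cs.length w),
        tInv cs n i * x ∈ lengthLT cs (T n) (cs.length w + 1) := by
      intro x hx
      induction hx using Submodule.span_induction with
      | mem x hx =>
        obtain ⟨y, hy, rfl⟩ := hx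
        have hy : cs.length y < cs.length w := hy
        have h1 := cs.length_simple_mul y i
        rw [tInv, add_mul, smul_mul_assoc, smul_mul_assoc, one_mul]
        refine add_mem (Submodule.smul_mem _ _ ?_)
          (Submodule.smul_mem _ _ (t_mem_lengthLT (by omega)))
        by_cases h : cs.length y < cs.length (cs.simple i * y)
        · rw [simple_mul_t_of_lt cs _ h]
          exact t_mem_lengthLT (by omega)
        · rw [simple_mul_t_of_not_lt cs _ h]
          exact add_mem (Submodule.smul_mem _ _ (t_mem_lengthLT (by omega)))
            (Submodule.smul_mem _ _ (t_mem_lengthLT (by omega)))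
      | zero => simp
      | add x y _ _ hx hy => rw [mul_add]; exact add_mem hx hy
      | smul r x _ hx => rw [mul_smul_comm]; exact Submodule.smul_mem _ _ hx
    have key := hmul _ ih
    rw [← simple_mul_t_of_lt cs _ hl, map_mul, bar_t_simple, simple_mul_t_of_lt cs _ hl, hl']
    rw [mul_sub, mul_smul_comm] at key
    have e : tInv cs n i * t cs (T n) w = (T (-n) : ℤ[T;T⁻¹]) • t cs (T n) (cs.simple i * w) +
        (T (-n) - 1 : ℤ[T;T⁻¹]) • t cs (T n) w := by
      rw [tInv, add_mul, smul_mul_assoc, smul_mul_assoc, one_mul, simple_mul_t_of_lt cs _ hl]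
    rw [e, smul_add, T_smul_T_smul, ← sub_sub, smul_smul] at key
    have e2 : -(n * (cs.length w : ℤ)) + -n = -(n * ((cs.length w + 1 : ℕ) : ℤ)) := by
      push_cast; ring
    rw [e2] at key
    have := add_mem key (Submodule.smul_mem _ (T (-(n * (cs.length w : ℤ))) * (T (-n) - 1) :
      ℤ[T;T⁻¹]) (t_mem_lengthLT (u := (T n : ℤ[T;T⁻¹])) (Nat.lt_succ_self (cs.length w))))
    rwa [sub_add_cancel] at this

/-- On the top layer of the length filtration only the diagonal entries of the bar operator
contribute. -/
theorem repr_bar_of_mem {k : ℕ} {x : HeckeAlgebra cs (T n : ℤ[T;T⁻¹])}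
    (hx : x ∈ lengthLT cs (T n) (k + 1)) {y : W} (hy : cs.length y = k) :
    (basis cs (T n)).repr (bar cs n x) y =
      LaurentPolynomial.invert ((basis cs (T n)).repr x y) * T (-(n * k)) := by
  classical
  induction hx using Submodule.span_induction with
  | mem x hx =>
    obtain ⟨w, hw, rfl⟩ := hx
    have hw : cs.length w < k + 1 := hw
    have h := mem_lengthLT_iff.1 (bar_t_sub_mem cs n w) y (by omega)
    rw [map_sub, Finsupp.sub_apply, sub_eq_zero] at h
    rw [h]
    by_cases hwy : w = y
    · subst hwy
      simp [hy]
    · simp [hwy]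
  | zero => simp
  | add a b _ _ ha hb => simp only [map_add, Finsupp.add_apply, ha, hb, add_mul]
  | smul r a _ ha =>
    simp only [bar_smul, map_smul, Finsupp.smul_apply, ha, smul_eq_mul, map_mul, mul_assoc]

/-- A bar invariant element all of whose coordinates with respect to the normalized basis
`u^{-ℓ(w)/2} t_w` lie in `v⁻¹ ℤ[v⁻¹]` vanishes. -/
theorem eq_zero_of_bar_eq {m : ℤ} (hn : n = 2 * m) {x : HeckeAlgebra cs (T n : ℤ[T;T⁻¹])}
    (hx : bar cs n x = x)
    (hneg : ∀ y, ∀ e : ℤ, 0 ≤ e →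
      (T (m * cs.length y) * (basis cs (T n)).repr x y : ℤ[T;T⁻¹]).coeff e = 0) : x = 0 := by
  obtain ⟨k, hk⟩ := exists_mem_lengthLT x
  induction k with
  | zero => exact eq_zero_of_mem_lengthLT_zero hk
  | succ k ih =>
    apply ih
    rw [mem_lengthLT_iff]
    intro y hy
    rcases Nat.lt_or_ge k (cs.length y) with h | h
    · exact mem_lengthLT_iff.1 hk y h
    have hy : cs.length y = k := le_antisymm h hy
    have h1 := repr_bar_of_mem cs n hk hy
    rw [hx] at h1
    have h2 := hneg y
    set a := (basis cs (T n : ℤ[T;T⁻¹])).repr x y with ha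
    rw [hy] at h2
    have h3 : LaurentPolynomial.invert (T (m * k) * a) = (T (m * k) * a : ℤ[T;T⁻¹]) := by
      conv_rhs => rw [h1]
      -- The normalization `v^{mℓ(y)}` with `n = 2m` is exactly what makes a top coefficient
      -- invariant under `v ↦ v⁻¹`. An invariant Laurent polynomial without nonnegative exponents is
      -- zero.
      rw [map_mul, LaurentPolynomial.invert_T, mul_comm (LaurentPolynomial.invert a), ← mul_assoc,
        ← LaurentPolynomial.T_add]
      congr 2
      rw [hn]; ring
    have h4 : (T (m * k) * a : ℤ[T;T⁻¹]) = 0 := by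
      apply LaurentPolynomial.ext
      intro e
      rcases le_total 0 e with he | he
      · simpa using h2 e he
      · rw [← h3, LaurentPolynomial.invert_apply]
        simpa using h2 (-e) (by omega)
    have h5 : (T (-(m * k)) * (T (m * k) * a) : ℤ[T;T⁻¹]) = a := by
      rw [← mul_assoc, ← LaurentPolynomial.T_add]; simp
    rw [← h5, h4, mul_zero]

end Bar

end HeckeAlgebra

/-- `coords` is an arbitrary inverse function; it is a genuine left inverse because a basis is
linearly independent. -/
theorem coords_basis {ι V : Type*} [AddCommGroup V] [Module ℤ[T;T⁻¹] V]
    (b : Module.Basis ι ℤ[T;T⁻¹] V) (x : V) : coords b x = b.repr x := by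
  rw [coords]
  conv_lhs => rw [← b.linearCombination_repr x]
  exact Function.leftInverse_invFun b.linearIndependent _

theorem coords_eq_of_eq_basis {ι V : Type*} [AddCommGroup V] [Module ℤ[T;T⁻¹] V]
    (b : Module.Basis ι ℤ[T;T⁻¹] V) {e : ι → V} (h : ∀ i, b i = e i) (x : V) :
    coords e x = b.repr x := by
  rw [← funext h, coords_basis]

/-! ### Substitutions of powers of `v` -/

section EvalT

open LaurentPolynomial (T)

/-- The substitution `X ↦ v ^ n`. -/
def evalT (n : ℤ) : ℤ[X] →+* ℤ[T;T⁻¹] := (aeval (T n : ℤ[T;T⁻¹])).toRingHom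

theorem evalT_apply (n : ℤ) (p : ℤ[X]) : evalT n p = aeval (T n : ℤ[T;T⁻¹]) p := rfl

theorem evalT_X (n : ℤ) : evalT n X = T n := aeval_X _

theorem evalT_injective : Function.Injective (evalT 2) := by
  have h : ∀ p, evalT 2 p = toLaurent (expand ℤ 2 p) := by
    have : (evalT 2) = toLaurent.comp (expand ℤ 2 : ℤ[X] →ₐ[ℤ] ℤ[X]).toRingHom := by
      apply Polynomial.ringHom_ext'
      · exact RingHom.ext_int _ _
      · simp [evalT_X]
    intro p
    rw [this]; rfl
  intro p q hpq
  rw [h, h] at hpq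
  exact expand_injective two_pos (toLaurent_injective hpq)

/-- The coefficient of `X^j` lands in exponent `e + 2j` only. This converts degree bounds on
polynomials in `q` into the negativity hypothesis of `eq_zero_of_bar_eq`. -/
theorem coeff_T_mul_evalT {e : ℤ} {p : ℤ[X]} (h : ∀ j : ℕ, 0 ≤ e + 2 * j → p.coeff j = 0) (z : ℤ)
    (hz : 0 ≤ z) : (T e * evalT 2 p : ℤ[T;T⁻¹]).coeff z = 0 := by
  rw [evalT_apply, aeval_eq_sum_range, Finset.mul_sum, AddMonoidAlgebra.coeff_sum,
    Finsupp.finsetSum_apply]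
  refine Finset.sum_eq_zero fun j _ => ?_
  rw [mul_smul_comm, LaurentPolynomial.T_pow, ← LaurentPolynomial.T_add,
    AddMonoidAlgebra.coeff_smul, Finsupp.smul_apply, LaurentPolynomial.T_apply]
  split_ifs with he
  · rw [h j (by omega), zero_smul]
  · rw [smul_zero]

theorem laurentSq_T (n : ℤ) : laurentSq (T n) = T (2 * n) := by
  exact AddMonoidAlgebra.mapDomain_single

theorem laurentSq_evalT (p : ℤ[X]) : laurentSq (evalT 2 p) = evalT 4 p := by
  have : laurentSq.comp (evalT 2) = evalT 4 := by
    apply Polynomial.ringHom_ext'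
    · exact RingHom.ext_int _ _
    · rw [RingHom.comp_apply, evalT_X, laurentSq_T, evalT_X]; norm_num
  exact RingHom.congr_fun this p

theorem invert_laurentSq (p : ℤ[T;T⁻¹]) :
    LaurentPolynomial.invert (laurentSq p) = laurentSq (LaurentPolynomial.invert p) := by
  induction p using LaurentPolynomial.induction_on' with
  | add p q hp hq => simp only [map_add, hp, hq]
  | C_mul_T n a =>
    have h : ∀ a : ℤ, laurentSq (LaurentPolynomial.C a) = LaurentPolynomial.C a := fun a => by
      simp
    simp only [map_mul, LaurentPolynomial.invert_T, laurentSq_T, LaurentPolynomial.invert_C, h,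
      mul_neg]

theorem evalT_two_comp (p : ℤ[X]) : evalT 2 (p.comp (X ^ 2)) = evalT 4 p := by
  have : (evalT 2).comp (compRingHom (X ^ 2)) = evalT 4 := by
    apply Polynomial.ringHom_ext'
    · exact RingHom.ext_int _ _
    · rw [RingHom.comp_apply, coe_compRingHom_apply, X_comp, map_pow, evalT_X, evalT_X,
        LaurentPolynomial.T_pow]
      norm_num
  exact RingHom.congr_fun this p

end EvalT

/-! ### Existence, uniqueness and symmetry of Kazhdan-Lusztig elements -/

namespace HeckeAlgebra

open LaurentPolynomial (T)

variable {B W : Type*} [Group W] {M : CoxeterMatrix B} (cs : CoxeterSystem M W)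

/-- The substitution `X ↦ v ^ n` on the Hecke algebra with generic parameter `X`. -/
def spec (n : ℤ) : HeckeAlgebra cs (X : ℤ[X]) →+* HeckeAlgebra cs (T n : ℤ[T;T⁻¹]) :=
  baseChange cs (evalT n) (evalT_X n)

theorem spec_eq_sum (n : ℤ) (x : HeckeAlgebra cs (X : ℤ[X])) :
    spec cs n x = ((basis cs (X : ℤ[X])).repr x).sum fun y p =>
      aeval (T n : ℤ[T;T⁻¹]) p • t cs (T n) y := by
  conv_lhs => rw [← (basis cs (X : ℤ[X])).linearCombination_repr x]
  rw [Finsupp.linearCombination_apply, Finsupp.sum, map_sum]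
  refine Finset.sum_congr rfl fun y _ => ?_
  rw [spec, baseChange_smul, basis_apply, baseChange_t]
  rfl

theorem klCombination_repr (w : W) (x : HeckeAlgebra cs (X : ℤ[X])) :
    klCombination cs w ((basis cs X).repr x) =
      (T (-(cs.length w : ℤ)) : ℤ[T;T⁻¹]) • spec cs 2 x := by
  rw [klCombination, spec_eq_sum]

/-- The properties characterizing the element `∑_y P_{y,w} t_y` of the Hecke algebra with generic
parameter. -/
structure IsKLElement (w : W) (x : HeckeAlgebra cs (X : ℤ[X])) : Prop where
  bar_eq : bar cs 2 ((T (-(cs.length w : ℤ)) : ℤ[T;T⁻¹]) • spec cs 2 x) =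
    (T (-(cs.length w : ℤ)) : ℤ[T;T⁻¹]) • spec cs 2 x
  eq_one : (basis cs X).repr x w = 1
  le : ∀ y, (basis cs X).repr x y ≠ 0 → cs.BruhatLE y w
  coeff_eq_zero : ∀ y ≠ w, ∀ j, cs.length w ≤ 2 * j + cs.length y →
    ((basis cs X).repr x y).coeff j = 0

variable {cs}

/-- The bound on `natDegree` is traded for vanishing of individual coefficients, a condition that
behaves well under sums, products and multiplication by powers of `X`. -/
theorem isKLFamily_repr {w : W} {x : HeckeAlgebra cs (X : ℤ[X])} :
    IsKLFamily cs w ((basis cs X).repr x) ↔ IsKLElement cs w x := by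
  constructor
  · intro h
    have hb := h.bar_eq
    rw [klCombination_repr, ← bar_apply] at hb
    refine ⟨hb, h.eq_one, fun y hy => ?_, fun y hne j hj => ?_⟩
    · by_contra hle
      refine hy (h.eq_zero y (fun h' => hle h'.1) ?_)
      rintro rfl
      exact hle (cs.bruhatLE_refl _)
    · by_cases hlt : cs.BruhatLT y w
      · have := h.degree_le y hlt
        exact coeff_eq_zero_of_natDegree_lt (by omega)
      · rw [h.eq_zero y hlt hne, coeff_zero]
  · intro h
    refine ⟨?_, h.eq_one, fun y hy hne => ?_, fun y hlt => ?_⟩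
    · rw [klCombination_repr, ← bar_apply]
      exact h.bar_eq
    · by_contra h0
      exact hy ⟨h.le y h0, hne⟩
    · have hl := hlt.length_lt
      have := natDegree_le_iff_coeff_eq_zero (p := (basis cs X).repr x y)
        (n := (cs.length w - cs.length y - 1) / 2)
      have := this.2 fun j hj => h.coeff_eq_zero y hlt.2 j (by omega)
      omega

theorem IsKLElement.repr_eq_zero {w y : W} {x : HeckeAlgebra cs (X : ℤ[X])}
    (h : IsKLElement cs w x) (hl : cs.length w ≤ cs.length y) (hne : y ≠ w) :
    (basis cs X).repr x y = 0 := by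
  by_contra h0
  rcases cs.length_le_of_bruhatLE (h.le y h0) with h1 | h1
  · exact hne h1
  · omega

/-- In the difference the diagonal coefficients cancel and all others, once normalized, involve only
negative powers of `v`; being bar invariant, it vanishes. Specialization at `X = v²` loses nothing.
-/
theorem IsKLElement.unique {w : W} {x x' : HeckeAlgebra cs (X : ℤ[X])}
    (h : IsKLElement cs w x) (h' : IsKLElement cs w x') : x = x' := by
  have h0 : (T (-(cs.length w : ℤ)) : ℤ[T;T⁻¹]) • spec cs 2 (x - x') = 0 := by
    refine eq_zero_of_bar_eq cs 2 (m := 1) rfl ?_ ?_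
    · rw [map_sub, smul_sub, map_sub, h.bar_eq, h'.bar_eq]
    · intro y e he
      rw [map_smul, Finsupp.smul_apply, smul_eq_mul, ← mul_assoc, ← LaurentPolynomial.T_add, spec,
        repr_baseChange]
      refine coeff_T_mul_evalT (fun j hj => ?_) e he
      rw [map_sub, Finsupp.sub_apply, coeff_sub]
      by_cases hy : y = w
      · rw [hy, h.eq_one, h'.eq_one, sub_self]
      · rw [h.coeff_eq_zero y hy j (by omega), h'.coeff_eq_zero y hy j (by omega), sub_self]
  have h1 : spec cs 2 (x - x') = 0 := by
    have := congrArg (fun z => (T (cs.length w : ℤ) : ℤ[T;T⁻¹]) • z) h0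
    simpa [T_smul_T_smul] using this
  rw [← sub_eq_zero]
  refine (basis cs (X : ℤ[X])).repr.injective (Finsupp.ext fun y => ?_)
  apply evalT_injective
  have := DFunLike.congr_fun (congrArg (basis cs (T 2 : ℤ[T;T⁻¹])).repr h1) y
  rw [spec, repr_baseChange] at this
  rw [this]; simp

/-- Here the degree bound may fail by attaining the borderline value `(ℓ(w) - ℓ(z)) / 2`.
Subtracting `μ(z) c_z`, with `μ(z)` the borderline coefficient, repairs it at `z`. All corrections
can be made at once, since `c_z` contributes only below the borderline at every `y ≠ z`. -/
theorem exists_isKLElement_of_weak {w : W} (A : HeckeAlgebra cs (X : ℤ[X]))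
    (hbar : bar cs 2 ((T (-(cs.length w : ℤ)) : ℤ[T;T⁻¹]) • spec cs 2 A) =
      (T (-(cs.length w : ℤ)) : ℤ[T;T⁻¹]) • spec cs 2 A)
    (hone : (basis cs X).repr A w = 1)
    (hle : ∀ y, (basis cs X).repr A y ≠ 0 → cs.BruhatLE y w)
    (hdeg : ∀ y ≠ w, ∀ j, cs.length w < 2 * j + cs.length y → ((basis cs X).repr A y).coeff j = 0)
    (ih : ∀ z, cs.length z < cs.length w → ∃ x, IsKLElement cs z x) :
    ∃ x, IsKLElement cs w x := by
  classical
  -- The value 0 outside the inductive range only serves to make the choice total.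
  have ih' : ∀ z, ∃ x, cs.length z < cs.length w → IsKLElement cs z x := fun z => by
    by_cases h : cs.length z < cs.length w
    · obtain ⟨x, hx⟩ := ih z h
      exact ⟨x, fun _ => hx⟩
    · exact ⟨0, fun h' => absurd h' h⟩
  choose Q hQ' using ih'
  -- The borderline degree is an integer only for `z` of the same length parity as `w`.
  set S := ((basis cs X).repr A).support.filter
    (fun z => z ≠ w ∧ Even (cs.length w + cs.length z)) with hS
  let d : W → ℕ := fun z => (cs.length w - cs.length z) / 2
  let μ : W → ℤ := fun z => ((basis cs X).repr A z).coeff (d z)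
  have hmem : ∀ z ∈ S, cs.BruhatLE z w ∧ cs.length z < cs.length w ∧
      2 * d z + cs.length z = cs.length w := by
    intro z hz
    rw [hS, Finset.mem_filter, Finsupp.mem_support_iff] at hz
    obtain ⟨h1, h2, h3⟩ := hz
    have hl := CoxeterSystem.BruhatLT.length_lt ⟨hle z h1, h2⟩
    refine ⟨hle z h1, hl, ?_⟩
    have := Nat.even_iff.1 h3
    simp only [d]
    omega
  have hQ : ∀ z ∈ S, IsKLElement cs z (Q z) := fun z hz => hQ' z (hmem z hz).2.1
  have hrepr : ∀ y, (basis cs X).repr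
      (A - ∑ z ∈ S, (C (μ z) * X ^ d z : ℤ[X]) • Q z) y =
      (basis cs X).repr A y - ∑ z ∈ S, C (μ z) * (X ^ d z * (basis cs X).repr (Q z) y) := by
    intro y
    rw [map_sub, Finsupp.sub_apply, map_sum, Finsupp.finsetSum_apply]
    simp only [map_smul, Finsupp.smul_apply, smul_eq_mul, mul_assoc]
  refine ⟨A - ∑ z ∈ S, (C (μ z) * X ^ d z : ℤ[X]) • Q z, ?_, ?_, ?_, ?_⟩
  -- The factor `X^{d z}` specializes to `v^{ℓ(w) - ℓ(z)}` and so converts the normalization of `w`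
  -- into that of `z`: an integer multiple of a bar invariant element is subtracted.
  · have e : (T (-(cs.length w : ℤ)) : ℤ[T;T⁻¹]) •
        spec cs 2 (A - ∑ z ∈ S, (C (μ z) * X ^ d z : ℤ[X]) • Q z) =
        (T (-(cs.length w : ℤ)) : ℤ[T;T⁻¹]) • spec cs 2 A -
        ∑ z ∈ S, μ z • ((T (-(cs.length z : ℤ)) : ℤ[T;T⁻¹]) • spec cs 2 (Q z)) := by
      rw [map_sub, smul_sub, map_sum, Finset.smul_sum]
      congr 1
      refine Finset.sum_congr rfl fun z hz => ?_
      have h2 := (hmem z hz).2.2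
      rw [spec, baseChange_smul, map_mul, map_pow, evalT_X, LaurentPolynomial.T_pow, smul_smul,
        ← Int.cast_smul_eq_zsmul ℤ[T;T⁻¹], smul_smul]
      congr 1
      rw [show evalT 2 (C (μ z)) = ((μ z : ℤ) : ℤ[T;T⁻¹]) by simp, mul_left_comm,
        ← LaurentPolynomial.T_add]
      congr 2
      omega
    rw [e, map_sub, hbar, map_sum]
    congr 1
    refine Finset.sum_congr rfl fun z hz => ?_
    rw [map_zsmul, (hQ z hz).bar_eq]
  · rw [hrepr, hone, Finset.sum_eq_zero, sub_zero]
    intro z hz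
    obtain ⟨-, h1, -⟩ := hmem z hz
    rw [(hQ z hz).repr_eq_zero h1.le (by rintro rfl; exact lt_irrefl _ h1), mul_zero, mul_zero]
  · intro y hy
    by_contra hcon
    apply hy
    have h0 : (basis cs X).repr A y = 0 := by
      by_contra h; exact hcon (hle y h)
    rw [hrepr, h0, Finset.sum_eq_zero, sub_zero]
    intro z hz
    have : (basis cs X).repr (Q z) y = 0 := by
      by_contra h; exact hcon (((hQ z hz).le y h).trans (hmem z hz).1)
    rw [this, mul_zero, mul_zero]
  · intro y hne k hk
    have hz0 : ∀ z ∈ S, z ≠ y →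
        (C (μ z) * (X ^ d z * (basis cs X).repr (Q z) y)).coeff k = 0 := by
      intro z hz hzy
      have h2 := (hmem z hz).2.2
      rw [coeff_C_mul, coeff_X_pow_mul']
      split_ifs with h
      · rw [(hQ z hz).coeff_eq_zero y hzy.symm _ (by omega), mul_zero]
      · rw [mul_zero]
    rw [hrepr, coeff_sub, finsetSum_coeff]
    by_cases hy : y ∈ S
    · have h2 := (hmem y hy).2.2
      rw [Finset.sum_eq_single_of_mem y hy hz0, (hQ y hy).eq_one, mul_one, coeff_C_mul, coeff_X_pow]
      by_cases hkd : k = d y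
      · rw [if_pos hkd, mul_one, hkd, sub_self]
      · rw [if_neg hkd, mul_zero, sub_zero]
        exact hdeg y hne k (by omega)
    · rw [Finset.sum_eq_zero fun z hz => hz0 z hz (by rintro rfl; exact hy hz), sub_zero]
      by_cases hA : (basis cs X).repr A y = 0
      · rw [hA, coeff_zero]
      · refine hdeg y hne k (lt_of_le_of_ne hk fun he => hy ?_)
        rw [hS, Finset.mem_filter, Finsupp.mem_support_iff]
        exact ⟨hA, hne, ⟨k + cs.length y, by omega⟩⟩

theorem bar_simple_add_one (i : B) :
    bar cs 2 ((T (-1) : ℤ[T;T⁻¹]) • (t cs (T 2) (cs.simple i) + 1)) =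
      (T (-1) : ℤ[T;T⁻¹]) • (t cs (T 2) (cs.simple i) + 1) := by
  rw [bar_smul, map_add, map_one, bar_t_simple, tInv, LaurentPolynomial.invert_T, neg_neg, sub_smul,
    one_smul, ← add_sub_assoc, sub_add_cancel, ← smul_add, T_smul_T_smul]
  norm_num

open Classical in
theorem repr_simple_add_one_mul (i : B) (x : HeckeAlgebra cs (X : ℤ[X])) (y : W) :
    (basis cs X).repr ((t cs X (cs.simple i) + 1) * x) y =
      if cs.length (cs.simple i * y) < cs.length y then
        (basis cs X).repr x (cs.simple i * y) + X * (basis cs X).repr x y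
      else X * (basis cs X).repr x (cs.simple i * y) + (basis cs X).repr x y := by
  rw [add_mul, one_mul, map_add, Finsupp.add_apply, repr_simple_mul]
  split_ifs <;> ring

/-- The product `c_s c_w` is bar invariant. Multiplication by `t_s + 1` mixes the coordinates at `y`
and `s y` with at most one factor `X`; against the length growth of one, the strict degree bound
weakens to the one needed by `exists_isKLElement_of_weak`. -/
theorem IsKLElement.exists_simple_mul {w : W} {i : B}
    (hl : cs.length w < cs.length (cs.simple i * w)) {x : HeckeAlgebra cs (X : ℤ[X])}
    (hx : IsKLElement cs w x)
    (ih : ∀ z, cs.length z < cs.length (cs.simple i * w) → ∃ x, IsKLElement cs z x) :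
    ∃ x, IsKLElement cs (cs.simple i * w) x := by
  have hl' : cs.length (cs.simple i * w) = cs.length w + 1 := by
    have := cs.length_simple_mul w i; omega
  have cancel : ∀ y, cs.simple i * y = w → y = cs.simple i * w := by
    rintro y rfl; simp
  refine exists_isKLElement_of_weak ((t cs X (cs.simple i) + 1) * x) ?_ ?_ ?_ ?_ ih
  · have e : (T (-(cs.length (cs.simple i * w) : ℤ)) : ℤ[T;T⁻¹]) •
        spec cs 2 ((t cs X (cs.simple i) + 1) * x) =
        ((T (-1) : ℤ[T;T⁻¹]) • (t cs (T 2) (cs.simple i) + 1)) *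
        ((T (-(cs.length w : ℤ)) : ℤ[T;T⁻¹]) • spec cs 2 x) := by
      rw [map_mul, map_add, map_one, smul_mul_smul_comm, ← LaurentPolynomial.T_add, hl']
      congr 2
      · push_cast; ring
      · rw [spec, baseChange_t]
    rw [e, map_mul, bar_simple_add_one, hx.bar_eq]
  · rw [repr_simple_add_one_mul, if_pos (by simpa using hl), cs.simple_mul_simple_cancel_left,
      hx.eq_one, hx.repr_eq_zero hl.le (by intro h; rw [h] at hl; exact lt_irrefl _ hl), mul_zero,
      add_zero]
  · intro y hy
    have hor : (basis cs X).repr x (cs.simple i * y) ≠ 0 ∨ (basis cs X).repr x y ≠ 0 := by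
      by_contra hcon
      push Not at hcon
      apply hy
      rw [repr_simple_add_one_mul, hcon.1, hcon.2]
      simp
    rcases hor with h | h
    · exact cs.bruhatLE_simple_mul_of_simple_mul_le hl (hx.le _ h)
    · exact (hx.le _ h).trans (cs.bruhatLE_simple_mul hl)
  · intro y hne j hj
    have hne' : cs.simple i * y ≠ w := fun h => hne (cancel y h)
    have h1 := cs.length_simple_mul y i
    rw [repr_simple_add_one_mul]
    split_ifs with hy
    · rw [coeff_add, hx.coeff_eq_zero _ hne' j (by omega), zero_add]
      cases j with
      | zero => exact coeff_X_mul_zero _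
      | succ k =>
        rw [coeff_X_mul]
        refine hx.coeff_eq_zero y ?_ k (by omega)
        rintro rfl
        omega
    · have h2 : ((basis cs X).repr x y).coeff j = 0 := by
        -- At `y = w` the coefficient is the constant 1, and `hj` excludes `j = 0`.
        by_cases hyw : y = w
        · rw [hyw, hx.eq_one, coeff_one, if_neg]
          rw [hyw] at hj
          omega
        · exact hx.coeff_eq_zero y hyw j (by omega)
      rw [coeff_add, h2, add_zero]
      cases j with
      | zero => exact coeff_X_mul_zero _
      | succ k =>
        rw [coeff_X_mul]
        exact hx.coeff_eq_zero _ hne' k (by omega)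

theorem isKLElement_one : IsKLElement cs 1 (1 : HeckeAlgebra cs (X : ℤ[X])) := by
  classical
  have h : ∀ y, (basis cs (X : ℤ[X])).repr 1 y = if 1 = y then 1 else 0 := fun y => by
    rw [← t_one, repr_t, Finsupp.single_apply]
  refine ⟨by simp, by rw [h, if_pos rfl], fun y hy => ?_, fun y hy j _ => ?_⟩
  · rw [h] at hy
    split_ifs at hy with h1
    · rw [h1]; exact cs.bruhatLE_refl _
    · exact absurd rfl hy
  · rw [h, if_neg hy.symm, coeff_zero]

theorem exists_isKLElement (w : W) : ∃ x, IsKLElement cs w x := by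
  induction h : cs.length w using Nat.strong_induction_on generalizing w with
  | _ n ih =>
    subst h
    by_cases hw : w = 1
    · exact hw ▸ ⟨1, isKLElement_one⟩
    obtain ⟨i, hi⟩ := cs.exists_leftDescent_of_ne_one hw
    obtain ⟨v, rfl⟩ : ∃ v, w = cs.simple i * v := ⟨cs.simple i * w, by simp⟩
    have hl : cs.length v < cs.length (cs.simple i * v) := by
      simpa [CoxeterSystem.IsLeftDescent] using hi
    obtain ⟨x, hx⟩ := ih _ hl v rfl
    exact hx.exists_simple_mul hl fun z hz => ih _ hz z rfl

variable (cs)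

/-- The element `∑_y P_{y,w} t_y` of the Hecke algebra with generic parameter. -/
def klElement (w : W) : HeckeAlgebra cs (X : ℤ[X]) := (basis cs X).repr.symm (klFamily cs w)

theorem repr_klElement (w : W) : (basis cs X).repr (klElement cs w) = klFamily cs w :=
  (basis cs X).repr.apply_symm_apply _

theorem repr_klElement_apply (w y : W) : (basis cs X).repr (klElement cs w) y = klP cs y w := by
  rw [repr_klElement, klP]

/-- Existence puts `klFamily` in the nontrivial branch of its definition. -/
theorem isKLElement_klElement (w : W) : IsKLElement cs w (klElement cs w) := by
  rw [← isKLFamily_repr, repr_klElement, klFamily]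
  have h : ∃ P, IsKLFamily cs w P := by
    obtain ⟨x, hx⟩ := exists_isKLElement (cs := cs) w
    exact ⟨_, isKLFamily_repr.2 hx⟩
  rw [dif_pos h]
  exact h.choose_spec

theorem klc_eq (w : W) :
    klc cs w = (T (-(cs.length w : ℤ)) : ℤ[T;T⁻¹]) • spec cs 2 (klElement cs w) := by
  rw [klc, ← klCombination_repr, repr_klElement]

theorem klC_eq (w : W) :
    klC cs w = (T (-2 * (cs.length w : ℤ)) : ℤ[T;T⁻¹]) • spec cs 4 (klElement cs w) := by
  rw [klC, spec_eq_sum, repr_klElement]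

theorem bar_klc (w : W) : bar cs 2 (klc cs w) = klc cs w := by
  rw [klc_eq]
  exact (isKLElement_klElement cs w).bar_eq

/-- The substitution `v ↦ v²` from the Hecke algebra with parameter `v²` to the one with parameter
`v⁴`. -/
def heckeSq : HeckeAlgebra cs (T 2 : ℤ[T;T⁻¹]) →+* HeckeAlgebra cs (T 4 : ℤ[T;T⁻¹]) :=
  baseChange cs laurentSq (by rw [laurentSq_T]; norm_num)

theorem heckeSq_t (w : W) : heckeSq cs (t cs (T 2) w) = t cs (T 4) w := baseChange_t cs _ _ w

theorem heckeSq_smul (r : ℤ[T;T⁻¹]) (x : HeckeAlgebra cs (T 2 : ℤ[T;T⁻¹])) :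
    heckeSq cs (r • x) = laurentSq r • heckeSq cs x := baseChange_smul cs _ _ r x

/-- Both elements come from the same generic one: `X ↦ v²` followed by `v ↦ v²` is `X ↦ v⁴`.
Products of the `C_w` are thereby images of products of the `c_w`. -/
theorem heckeSq_klc (w : W) : heckeSq cs (klc cs w) = klC cs w := by
  rw [klc_eq, klC_eq, heckeSq_smul, laurentSq_T, mul_neg, neg_mul]
  congr 1
  refine (basis cs _).repr.injective (Finsupp.ext fun y => ?_)
  rw [heckeSq, repr_baseChange, spec, repr_baseChange, laurentSq_evalT, spec, repr_baseChange]

theorem bar_heckeSq (x : HeckeAlgebra cs (T 2 : ℤ[T;T⁻¹])) :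
    bar cs 4 (heckeSq cs x) = heckeSq cs (bar cs 2 x) := by
  induction x using induction with
  | zero => simp
  | add a b ha hb => simp only [map_add, ha, hb]
  | smul r w =>
    rw [heckeSq_smul, bar_smul, bar_smul, heckeSq_smul, heckeSq_t, bar_t, bar_t,
      RingHom.map_ringInverse_of_isUnit _ (isUnit_t cs 2 _), heckeSq_t, invert_laurentSq]

theorem bar_klC (w : W) : bar cs 4 (klC cs w) = klC cs w := by
  rw [← heckeSq_klc, bar_heckeSq, bar_klc]

theorem flip_heckeSq (x : HeckeAlgebra cs (T 2 : ℤ[T;T⁻¹])) :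
    flip cs (T 4) (heckeSq cs x) = heckeSq cs (flip cs (T 2) x) := by
  induction x using induction with
  | zero => simp
  | add a b ha hb => simp only [map_add, ha, hb]
  | smul r w => rw [heckeSq_smul, map_smul (flip cs (T 4)), map_smul (flip cs (T 2)), heckeSq_smul,
      heckeSq_t, flip_t, flip_t, heckeSq_t]

theorem flip_spec (n : ℤ) (x : HeckeAlgebra cs (X : ℤ[X])) :
    flip cs (T n) (spec cs n x) = spec cs n (flip cs X x) :=
  (basis cs _).repr.injective (Finsupp.ext fun y => by
    rw [repr_flip, spec, repr_baseChange, repr_baseChange, repr_flip])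

/-- `flip` commutes with the bar operator, and inversion preserves length and Bruhat order. With
uniqueness this yields `P_{y⁻¹,w⁻¹} = P_{y,w}`. -/
theorem isKLElement_flip {w : W} {x : HeckeAlgebra cs (X : ℤ[X])} (h : IsKLElement cs w x) :
    IsKLElement cs w⁻¹ (flip cs X x) := by
  refine ⟨?_, ?_, fun y hy => ?_, fun y hy j hj => ?_⟩
  · rw [← flip_spec, ← map_smul, bar_flip, cs.length_inv, h.bar_eq]
  · rw [repr_flip, inv_inv, h.eq_one]
  · rw [repr_flip] at hy
    have := (h.le _ hy).inv
    rwa [inv_inv] at this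
  · rw [repr_flip]
    refine h.coeff_eq_zero _ (fun h => hy ?_) j (by simpa using hj)
    rw [← h, inv_inv]

theorem flip_klElement (w : W) : flip cs X (klElement cs w) = klElement cs w⁻¹ :=
  (isKLElement_flip cs (isKLElement_klElement cs w)).unique (isKLElement_klElement cs w⁻¹)

theorem klP_inv (y w : W) : klP cs y⁻¹ w⁻¹ = klP cs y w := by
  rw [← repr_klElement_apply, ← flip_klElement, repr_flip, inv_inv, repr_klElement_apply]

theorem flip_klc (w : W) : flip cs (T 2) (klc cs w) = klc cs w⁻¹ := by
  rw [klc_eq, map_smul, flip_spec, flip_klElement, klc_eq, cs.length_inv]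

theorem flip_klC (w : W) : flip cs (T 4) (klC cs w) = klC cs w⁻¹ := by
  rw [← heckeSq_klc, flip_heckeSq, flip_klc, heckeSq_klc]

theorem spec_klElement_sub_mem (n : ℤ) (w : W) :
    spec cs n (klElement cs w) - t cs (T n) w ∈ lengthLT cs (T n) (cs.length w) := by
  classical
  have h := isKLElement_klElement cs w
  rw [mem_lengthLT_iff]
  intro y hy
  rw [map_sub, Finsupp.sub_apply, spec, repr_baseChange, repr_t]
  by_cases hyw : y = w
  · rw [hyw, h.eq_one]; simp
  · rw [h.repr_eq_zero hy hyw, map_zero, Finsupp.single_apply, if_neg (Ne.symm hyw), sub_zero]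

/-- The unit `v ^ n`. -/
def unitT (n : ℤ) : ℤ[T;T⁻¹]ˣ where
  val := T n
  inv := T (-n)
  val_inv := by rw [← LaurentPolynomial.T_add]; simp
  inv_val := by rw [← LaurentPolynomial.T_add]; simp

theorem unitT_smul {V : Type*} [AddCommGroup V] [Module ℤ[T;T⁻¹] V] (n : ℤ) (x : V) :
    unitT n • x = (T n : ℤ[T;T⁻¹]) • x := rfl

/-- The Kazhdan-Lusztig basis `c_w`. -/
def klcBasis : Module.Basis W ℤ[T;T⁻¹] (HeckeAlgebra cs (T 2 : ℤ[T;T⁻¹])) :=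
  triangularBasis (fun w => unitT (cs.length w)) (klc cs) fun w => by
    rw [klc_eq, unitT_smul, T_smul_T_smul, add_neg_cancel, LaurentPolynomial.T_zero, one_smul]
    exact spec_klElement_sub_mem cs 2 w

theorem klcBasis_apply (w : W) : klcBasis cs w = klc cs w := triangularBasis_apply _ _ _ w

/-- The Kazhdan-Lusztig basis `C_w`. -/
def klCBasis : Module.Basis W ℤ[T;T⁻¹] (HeckeAlgebra cs (T 4 : ℤ[T;T⁻¹])) :=
  triangularBasis (fun w => unitT (2 * cs.length w)) (klC cs) fun w => by
    rw [klC_eq, unitT_smul, T_smul_T_smul, neg_mul, add_neg_cancel, LaurentPolynomial.T_zero,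
      one_smul]
    exact spec_klElement_sub_mem cs 4 w

theorem klCBasis_apply (w : W) : klCBasis cs w = klC cs w := triangularBasis_apply _ _ _ w

theorem klH_eq (x y : W) : klH cs x y = (klcBasis cs).repr (klc cs x * klc cs y) :=
  coords_eq_of_eq_basis _ (klcBasis_apply cs) _

/-- Expanding `c_w c_x` first and then each `c_g c_y` gives the defining sum. The triple product is
the form in which both kinds of structure constants are computed. -/
theorem klF_eq (w x y z : W) :
    klF cs w x y z = (klcBasis cs).repr (klc cs w * klc cs x * klc cs y) z := by
  have h : klc cs w * klc cs x = (klH cs w x).sum fun g a => a • klc cs g := by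
    rw [klH_eq]
    conv_lhs => rw [← (klcBasis cs).linearCombination_repr (klc cs w * klc cs x)]
    rw [Finsupp.linearCombination_apply]
    simp only [klcBasis_apply]
  rw [klF, h, Finsupp.sum, Finsupp.sum, Finset.sum_mul, map_sum, Finsupp.finsetSum_apply]
  refine Finset.sum_congr rfl fun g _ => ?_
  rw [smul_mul_assoc, map_smul, Finsupp.smul_apply, smul_eq_mul, klH_eq, klH_eq]

end HeckeAlgebra

/-! ### The Hecke algebra of a product as a tensor product -/

namespace HeckeAlgebra

section Prod

open LaurentPolynomial (T)

variable {B B' W W' : Type*} [Group W] [Group W'] {M : CoxeterMatrix B} {M' : CoxeterMatrix B'}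
variable (cs : CoxeterSystem M W) (cs' : CoxeterSystem M' W')

section General

variable {R : Type*} [CommRing R] (u : R)

theorem prod_simple_mul_inl (i : B) (w : W) (w' : W') :
    (cs.prod cs').simple (Sum.inl i) * (w, w') = (cs.simple i * w, w') := by
  rw [CoxeterSystem.prod_simple_inl, Prod.mk_mul_mk, one_mul]

theorem prod_simple_mul_inr (i : B') (w : W) (w' : W') :
    (cs.prod cs').simple (Sum.inr i) * (w, w') = (w, cs'.simple i * w') := by
  rw [CoxeterSystem.prod_simple_inr, Prod.mk_mul_mk, one_mul]

theorem t_inl_mul_t_of_lt {i : B} {w : W} (w' : W') (h : cs.length w < cs.length (cs.simple i * w)) :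
    t (cs.prod cs') u (cs.simple i, 1) * t (cs.prod cs') u (w, w') =
      t (cs.prod cs') u (cs.simple i * w, w') := by
  rw [← cs.prod_simple_inl cs', simple_mul_t_of_lt, prod_simple_mul_inl]
  rw [prod_simple_mul_inl, cs.prod_length, cs.prod_length]
  exact Nat.add_lt_add_right h _

theorem t_inl_mul_t_of_not_lt {i : B} {w : W} (w' : W')
    (h : ¬ cs.length w < cs.length (cs.simple i * w)) :
    t (cs.prod cs') u (cs.simple i, 1) * t (cs.prod cs') u (w, w') =
      u • t (cs.prod cs') u (cs.simple i * w, w') + (u - 1) • t (cs.prod cs') u (w, w') := by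
  rw [← cs.prod_simple_inl cs', simple_mul_t_of_not_lt, prod_simple_mul_inl]
  rw [prod_simple_mul_inl, cs.prod_length, cs.prod_length]
  exact fun h' => h (Nat.lt_of_add_lt_add_right h')

theorem t_inr_mul_t_of_lt {i : B'} (w : W) {w' : W'}
    (h : cs'.length w' < cs'.length (cs'.simple i * w')) :
    t (cs.prod cs') u (1, cs'.simple i) * t (cs.prod cs') u (w, w') =
      t (cs.prod cs') u (w, cs'.simple i * w') := by
  rw [← cs.prod_simple_inr cs', simple_mul_t_of_lt, prod_simple_mul_inr]
  rw [prod_simple_mul_inr, cs.prod_length, cs.prod_length]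
  exact Nat.add_lt_add_left h _

theorem t_inr_mul_t_of_not_lt {i : B'} (w : W) {w' : W'}
    (h : ¬ cs'.length w' < cs'.length (cs'.simple i * w')) :
    t (cs.prod cs') u (1, cs'.simple i) * t (cs.prod cs') u (w, w') =
      u • t (cs.prod cs') u (w, cs'.simple i * w') + (u - 1) • t (cs.prod cs') u (w, w') := by
  rw [← cs.prod_simple_inr cs', simple_mul_t_of_not_lt, prod_simple_mul_inr]
  rw [prod_simple_mul_inr, cs.prod_length, cs.prod_length]
  exact fun h' => h (Nat.lt_of_add_lt_add_left h')

/-- The embedding `t_w ↦ t_{(w, 1)}`. -/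
def inl : HeckeAlgebra cs u →ₐ[R] HeckeAlgebra (cs.prod cs') u :=
  let f : HeckeAlgebra cs u →ₗ[R] HeckeAlgebra (cs.prod cs') u :=
    (basis cs u).constr R fun w => t (cs.prod cs') u (w, 1)
  have ht : ∀ w, f (t cs u w) = t (cs.prod cs') u (w, 1) := fun w =>
    (basis cs u).constr_basis R _ w
  AlgHom.ofLinearMap f (ht 1)
    (map_mul_of_simple f.toAddMonoidHom (algebraMap R _) (fun r x => Algebra.commutes _ _)
      (fun r x => (map_smul f r x).trans (Algebra.smul_def _ _)) (ht 1) (fun i w => by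
        change f _ = f _ * f _
        rw [ht, ht]
        by_cases h : cs.length w < cs.length (cs.simple i * w)
        · rw [simple_mul_t_of_lt cs u h, t_inl_mul_t_of_lt cs cs' u 1 h, ht]
        · rw [simple_mul_t_of_not_lt cs u h, t_inl_mul_t_of_not_lt cs cs' u 1 h, map_add, map_smul,
            map_smul, ht, ht]))

theorem inl_t (w : W) : inl cs cs' u (t cs u w) = t (cs.prod cs') u (w, 1) :=
  (basis cs u).constr_basis R _ w

/-- The embedding `t_w ↦ t_{(1, w)}`. -/
def inr : HeckeAlgebra cs' u →ₐ[R] HeckeAlgebra (cs.prod cs') u :=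
  let f : HeckeAlgebra cs' u →ₗ[R] HeckeAlgebra (cs.prod cs') u :=
    (basis cs' u).constr R fun w => t (cs.prod cs') u (1, w)
  have ht : ∀ w, f (t cs' u w) = t (cs.prod cs') u (1, w) := fun w =>
    (basis cs' u).constr_basis R _ w
  AlgHom.ofLinearMap f (ht 1)
    (map_mul_of_simple f.toAddMonoidHom (algebraMap R _) (fun r x => Algebra.commutes _ _)
      (fun r x => (map_smul f r x).trans (Algebra.smul_def _ _)) (ht 1) (fun i w => by
        change f _ = f _ * f _
        rw [ht, ht]
        by_cases h : cs'.length w < cs'.length (cs'.simple i * w)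
        · rw [simple_mul_t_of_lt cs' u h, t_inr_mul_t_of_lt cs cs' u 1 h, ht]
        · rw [simple_mul_t_of_not_lt cs' u h, t_inr_mul_t_of_not_lt cs cs' u 1 h, map_add, map_smul,
            map_smul, ht, ht]))

theorem inr_t (w : W') : inr cs cs' u (t cs' u w) = t (cs.prod cs') u (1, w) :=
  (basis cs' u).constr_basis R _ w

theorem inl_t_mul_inr_t (w : W) (w' : W') :
    inl cs cs' u (t cs u w) * inr cs cs' u (t cs' u w') = t (cs.prod cs') u (w, w') := by
  rw [inr_t]
  induction w using cs.length_induction_left with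
  | one => rw [t_one, map_one, one_mul]
  | mul w i hl ih =>
    rw [← simple_mul_t_of_lt cs u hl, map_mul, mul_assoc, ih, inl_t, t_inl_mul_t_of_lt cs cs' u _ hl]

theorem inr_t_mul_inl_t (w : W) (w' : W') :
    inr cs cs' u (t cs' u w') * inl cs cs' u (t cs u w) = t (cs.prod cs') u (w, w') := by
  rw [inl_t]
  induction w' using cs'.length_induction_left with
  | one => rw [t_one, map_one, one_mul]
  | mul w i hl ih =>
    rw [← simple_mul_t_of_lt cs' u hl, map_mul, mul_assoc, ih, inr_t,
      t_inr_mul_t_of_lt cs cs' u _ hl]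

/-- On standard basis elements the product in either order is `t_{(w, w')}`; bilinearity does the
rest. -/
theorem inl_inr_commute (x : HeckeAlgebra cs u) (y : HeckeAlgebra cs' u) :
    Commute (inl cs cs' u x) (inr cs cs' u y) := by
  induction x using induction with
  | zero => simp
  | add a b ha hb => rw [map_add]; exact ha.add_left hb
  | smul r w =>
    rw [map_smul]
    refine Commute.smul_left ?_ r
    induction y using induction with
    | zero => simp
    | add a b ha hb => rw [map_add]; exact ha.add_right hb
    | smul s w' =>
      rw [map_smul]
      refine Commute.smul_right ?_ s
      rw [Commute, SemiconjBy, inl_t_mul_inr_t, inr_t_mul_inl_t]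

theorem inl_mul_inr_mul (x x' : HeckeAlgebra cs u) (y y' : HeckeAlgebra cs' u) :
    inl cs cs' u x * inr cs cs' u y * (inl cs cs' u x' * inr cs cs' u y') =
      inl cs cs' u (x * x') * inr cs cs' u (y * y') := by
  rw [map_mul, map_mul, (inl_inr_commute cs cs' u x' y).mul_mul_mul_comm]

theorem repr_inl_mul_inr (x : HeckeAlgebra cs u) (y : HeckeAlgebra cs' u) (w : W × W') :
    (basis (cs.prod cs') u).repr (inl cs cs' u x * inr cs cs' u y) w =
      (basis cs u).repr x w.1 * (basis cs' u).repr y w.2 := by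
  classical
  induction x using induction with
  | zero => simp
  | add a b ha hb => simp only [map_add, add_mul, Finsupp.add_apply, ha, hb]
  | smul r a =>
    induction y using induction with
    | zero => simp
    | add a b ha hb => simp only [map_add, mul_add, Finsupp.add_apply, ha, hb]
    | smul s b =>
      rw [map_smul, map_smul, smul_mul_smul_comm, inl_t_mul_inr_t]
      simp only [map_smul, repr_t, Finsupp.smul_apply, Finsupp.single_apply, smul_eq_mul,
        Prod.ext_iff]
      by_cases h1 : a = w.1 <;> by_cases h2 : b = w.2 <;> simp [h1, h2]

variable {S : Type*} [CommRing S] {u} {u' : S} (φ : R →+* S) (hu : φ u = u')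

theorem baseChange_inl_mul_inr (x : HeckeAlgebra cs u) (y : HeckeAlgebra cs' u) :
    baseChange (cs.prod cs') φ hu (inl cs cs' u x * inr cs cs' u y) =
      inl cs cs' u' (baseChange cs φ hu x) * inr cs cs' u' (baseChange cs' φ hu y) :=
  (basis (cs.prod cs') u').repr.injective (Finsupp.ext fun w => by
    rw [repr_baseChange, repr_inl_mul_inr, repr_inl_mul_inr, repr_baseChange, repr_baseChange,
      map_mul])

end General

theorem bar_inl (n : ℤ) (x : HeckeAlgebra cs (T n : ℤ[T;T⁻¹])) :
    bar (cs.prod cs') n (inl cs cs' (T n) x) = inl cs cs' (T n) (bar cs n x) := by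
  induction x using induction with
  | zero => simp
  | add a b ha hb => simp only [map_add, ha, hb]
  | smul r w =>
    rw [map_smul (inl cs cs' (T n)), bar_smul, bar_smul, map_smul (inl cs cs' (T n)), inl_t, bar_t,
      bar_t]
    refine congrArg _ ?_
    have := RingHom.map_ringInverse_of_isUnit (inl cs cs' (T n : ℤ[T;T⁻¹])).toRingHom
      (isUnit_t cs n w⁻¹)
    refine Eq.trans ?_ this.symm
    change _ = Ring.inverse (inl cs cs' (T n) _)
    rw [inl_t, Prod.inv_mk, inv_one]

theorem bar_inr (n : ℤ) (x : HeckeAlgebra cs' (T n : ℤ[T;T⁻¹])) :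
    bar (cs.prod cs') n (inr cs cs' (T n) x) = inr cs cs' (T n) (bar cs' n x) := by
  induction x using induction with
  | zero => simp
  | add a b ha hb => simp only [map_add, ha, hb]
  | smul r w =>
    rw [map_smul (inr cs cs' (T n)), bar_smul, bar_smul, map_smul (inr cs cs' (T n)), inr_t, bar_t,
      bar_t]
    refine congrArg _ ?_
    have := RingHom.map_ringInverse_of_isUnit (inr cs cs' (T n : ℤ[T;T⁻¹])).toRingHom
      (isUnit_t cs' n w⁻¹)
    refine Eq.trans ?_ this.symm
    change _ = Ring.inverse (inr cs cs' (T n) _)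
    rw [inr_t, Prod.inv_mk, inv_one]

theorem T_smul_spec_inl_mul_inr (n : ℤ) (k l : ℤ) (x : HeckeAlgebra cs (X : ℤ[X]))
    (y : HeckeAlgebra cs' (X : ℤ[X])) :
    (T (k + l) : ℤ[T;T⁻¹]) • spec (cs.prod cs') n (inl cs cs' X x * inr cs cs' X y) =
      inl cs cs' (T n) ((T k : ℤ[T;T⁻¹]) • spec cs n x) *
        inr cs cs' (T n) ((T l : ℤ[T;T⁻¹]) • spec cs' n y) := by
  rw [spec, baseChange_inl_mul_inr, map_smul, map_smul, smul_mul_smul_comm, LaurentPolynomial.T_add]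
  rfl

theorem neg_prod_length (w : W × W') :
    (-((cs.prod cs').length w : ℤ)) = -(cs.length w.1 : ℤ) + -(cs'.length w.2 : ℤ) := by
  rw [cs.prod_length]; push_cast; ring

/-- For the degree bound at a `z` differing from `w` in both coordinates: if `a₁ + a₂ = j` is in the
forbidden range for the product, then `a₁` or `a₂` is in the forbidden range of its factor, so every
term of the convolution vanishes. -/
theorem IsKLElement.prod {w : W × W'} {x : HeckeAlgebra cs (X : ℤ[X])}
    {y : HeckeAlgebra cs' (X : ℤ[X])} (hx : IsKLElement cs w.1 x) (hy : IsKLElement cs' w.2 y) :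
    IsKLElement (cs.prod cs') w (inl cs cs' X x * inr cs cs' X y) := by
  refine ⟨?_, ?_, fun z hz => ?_, fun z hz j hj => ?_⟩
  · rw [neg_prod_length, T_smul_spec_inl_mul_inr, map_mul, bar_inl, bar_inr, hx.bar_eq, hy.bar_eq]
  · rw [repr_inl_mul_inr, hx.eq_one, hy.eq_one, one_mul]
  · rw [repr_inl_mul_inr] at hz
    rw [cs.prod_bruhatLE]
    exact ⟨hx.le _ (left_ne_zero_of_mul hz), hy.le _ (right_ne_zero_of_mul hz)⟩
  · rw [cs.prod_length, cs.prod_length] at hj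
    rw [repr_inl_mul_inr]
    by_cases h1 : z.1 = w.1
    · have h2 : z.2 ≠ w.2 := fun h2 => hz (Prod.ext h1 h2)
      rw [h1, hx.eq_one, one_mul]
      rw [h1] at hj
      exact hy.coeff_eq_zero _ h2 j (by omega)
    · by_cases h2 : z.2 = w.2
      · rw [h2, hy.eq_one, mul_one]
        rw [h2] at hj
        exact hx.coeff_eq_zero _ h1 j (by omega)
      · rw [coeff_mul]
        refine Finset.sum_eq_zero fun a ha => ?_
        rw [Finset.HasAntidiagonal.mem_antidiagonal] at ha
        rcases Nat.lt_or_ge (2 * a.1 + cs.length z.1) (cs.length w.1) with h | h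
        · rw [hy.coeff_eq_zero _ h2 a.2 (by omega), mul_zero]
        · rw [hx.coeff_eq_zero _ h1 a.1 h, zero_mul]

theorem klElement_prod (w : W × W') : klElement (cs.prod cs') w =
    inl cs cs' X (klElement cs w.1) * inr cs cs' X (klElement cs' w.2) :=
  (isKLElement_klElement _ w).unique
    ((isKLElement_klElement cs w.1).prod cs cs' (isKLElement_klElement cs' w.2))

theorem klP_prod (y w : W × W') :
    klP (cs.prod cs') y w = klP cs y.1 w.1 * klP cs' y.2 w.2 := by
  rw [← repr_klElement_apply, klElement_prod, repr_inl_mul_inr, repr_klElement_apply,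
    repr_klElement_apply]

theorem klc_prod (w : W × W') : klc (cs.prod cs') w =
    inl cs cs' (T 2) (klc cs w.1) * inr cs cs' (T 2) (klc cs' w.2) := by
  rw [klc_eq, klElement_prod, neg_prod_length, T_smul_spec_inl_mul_inr, ← klc_eq, ← klc_eq]

theorem klC_prod (w : W × W') : klC (cs.prod cs') w =
    inl cs cs' (T 4) (klC cs w.1) * inr cs cs' (T 4) (klC cs' w.2) := by
  have e : (-2 * ((cs.prod cs').length w : ℤ)) =
      -2 * (cs.length w.1 : ℤ) + -2 * (cs'.length w.2 : ℤ) := by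
    rw [cs.prod_length]; push_cast; ring
  rw [klC_eq, klElement_prod, e, T_smul_spec_inl_mul_inr, ← klC_eq, ← klC_eq]

theorem klcBasis_repr_inl_mul_inr (x : HeckeAlgebra cs (T 2 : ℤ[T;T⁻¹]))
    (y : HeckeAlgebra cs' (T 2 : ℤ[T;T⁻¹])) (w : W × W') :
    (klcBasis (cs.prod cs')).repr (inl cs cs' (T 2) x * inr cs cs' (T 2) y) w =
      (klcBasis cs).repr x w.1 * (klcBasis cs').repr y w.2 := by
  classical
  conv_lhs =>
    rw [← (klcBasis cs).linearCombination_repr x, ← (klcBasis cs').linearCombination_repr y]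
  generalize (klcBasis cs).repr x = a
  generalize (klcBasis cs').repr y = b
  induction a using Finsupp.induction_linear with
  | zero => simp
  | add a a' ha ha' => simp only [map_add, add_mul, Finsupp.add_apply, ha, ha']
  | single z r =>
    induction b using Finsupp.induction_linear with
    | zero => simp
    | add b b' hb hb' => simp only [map_add, mul_add, Finsupp.add_apply, hb, hb']
    | single z' s =>
      rw [Finsupp.linearCombination_single, Finsupp.linearCombination_single, klcBasis_apply,
        klcBasis_apply, map_smul, map_smul, smul_mul_smul_comm, ← klc_prod cs cs' (z, z'),
        ← klcBasis_apply, map_smul, Module.Basis.repr_self]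
      simp only [Finsupp.smul_apply, Finsupp.single_apply, smul_eq_mul, Prod.ext_iff]
      by_cases h1 : z = w.1 <;> by_cases h2 : z' = w.2 <;> simp [h1, h2]

end Prod

end HeckeAlgebra

/-! ### Kazhdan-Lusztig coordinates under `v ↦ v²` and under inversion -/

namespace HeckeAlgebra

open LaurentPolynomial (T)

section

variable {B W : Type*} [Group W] {M : CoxeterMatrix B} (cs : CoxeterSystem M W)

theorem klCBasis_repr_heckeSq (x : HeckeAlgebra cs (T 2 : ℤ[T;T⁻¹])) (z : W) :
    (klCBasis cs).repr (heckeSq cs x) z = laurentSq ((klcBasis cs).repr x z) := by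
  classical
  conv_lhs => rw [← (klcBasis cs).linearCombination_repr x]
  generalize (klcBasis cs).repr x = a
  induction a using Finsupp.induction_linear with
  | zero => simp
  | add a b ha hb => simp only [map_add, Finsupp.add_apply, ha, hb]
  | single w r =>
    rw [Finsupp.linearCombination_single, klcBasis_apply, heckeSq_smul, heckeSq_klc,
      ← klCBasis_apply, map_smul, Module.Basis.repr_self]
    simp only [Finsupp.smul_apply, Finsupp.single_apply, smul_eq_mul]
    split_ifs <;> simp

theorem klcBasis_repr_flip (x : HeckeAlgebra cs (T 2 : ℤ[T;T⁻¹])) (z : W) :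
    (klcBasis cs).repr (flip cs (T 2) x) z⁻¹ = (klcBasis cs).repr x z := by
  classical
  conv_lhs => rw [← (klcBasis cs).linearCombination_repr x]
  generalize (klcBasis cs).repr x = a
  induction a using Finsupp.induction_linear with
  | zero => simp
  | add a b ha hb => simp only [map_add, Finsupp.add_apply, ha, hb]
  | single w r =>
    rw [Finsupp.linearCombination_single, klcBasis_apply, map_smul, flip_klc, ← klcBasis_apply,
      map_smul, Module.Basis.repr_self]
    simp only [Finsupp.smul_apply, Finsupp.single_apply, inv_inj, smul_eq_mul, mul_ite, mul_one,
      mul_zero]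

end

end HeckeAlgebra

/-! ### The module of twisted involutions for the swap -/

namespace SwapInvolution

open LaurentPolynomial (T)
open HeckeAlgebra

variable {B W : Type*} [Group W] {M : CoxeterMatrix B} (cs : CoxeterSystem M W)

/-- The twisted involutions of `W × W` are the pairs `(w, w⁻¹)`. -/
def twEquiv : W ≃ TwInv (swapInvolution cs) where
  toFun w := ⟨(w, w⁻¹), Prod.ext rfl (inv_inv w).symm⟩
  invFun y := y.1.1
  left_inv _ := rfl
  right_inv y := Subtype.ext (Prod.ext rfl (congrArg Prod.fst y.2).symm)

theorem twEquiv_val (w : W) : (twEquiv cs w).1 = (w, w⁻¹) := rfl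

theorem bruhatLE_twEquiv {y w : W} :
    (cs.prod cs).BruhatLE (twEquiv cs y).1 (twEquiv cs w).1 ↔ cs.BruhatLE y w := by
  rw [cs.prod_bruhatLE, twEquiv_val, twEquiv_val, cs.bruhatLE_inv_iff, and_self]

theorem twEquiv_val_inj {y w : W} : (twEquiv cs y).1 = (twEquiv cs w).1 ↔ y = w :=
  ⟨congrArg Prod.fst, congrArg fun w => (twEquiv cs w).1⟩

theorem bruhatLT_twEquiv {y w : W} :
    (cs.prod cs).BruhatLT (twEquiv cs y).1 (twEquiv cs w).1 ↔ cs.BruhatLT y w := by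
  rw [CoxeterSystem.BruhatLT, CoxeterSystem.BruhatLT, bruhatLE_twEquiv, Ne,
    twEquiv_val_inj]

/-- The doubling matches the normalization `v^{-ℓ}` of `A` with the normalization `q^{-ℓ(w)}` of
`C_w`. -/
theorem length_twEquiv (w : W) : (cs.prod cs).length (twEquiv cs w).1 = 2 * cs.length w := by
  rw [cs.prod_length, twEquiv_val, cs.length_inv, two_mul]

/-- The isomorphism `a_{(w, w⁻¹)} ↦ T_w` of the module of twisted involutions of `W × W` with the
Hecke algebra of `W`. -/
def twIso : TwModule (swapInvolution cs) ≃ₗ[ℤ[T;T⁻¹]] HeckeAlgebra cs (T 4 : ℤ[T;T⁻¹]) :=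
  (Finsupp.domLCongr (twEquiv cs).symm).trans (basis cs (T 4)).repr.symm

theorem twIso_single (w : W) (r : ℤ[T;T⁻¹]) :
    twIso cs (Finsupp.single (twEquiv cs w) r) = r • t cs (T 4) w := by
  rw [twIso, LinearEquiv.trans_apply, Finsupp.domLCongr_single, Equiv.symm_apply_apply,
    Module.Basis.repr_symm_single, basis_apply]

theorem twIso_a (w : W) : twIso cs (TwModule.a _ (twEquiv cs w)) = t cs (T 4) w := by
  rw [TwModule.a, twIso_single, one_smul]

theorem repr_twIso (m : TwModule (swapInvolution cs)) (w : W) :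
    (basis cs (T 4)).repr (twIso cs m) w = m (twEquiv cs w) := by
  rw [twIso, LinearEquiv.trans_apply, LinearEquiv.apply_symm_apply]
  rfl

theorem twModule_induction {p : TwModule (swapInvolution cs) → Prop} (zero : p 0)
    (add : ∀ x y, p x → p y → p (x + y))
    (smul : ∀ (r : ℤ[T;T⁻¹]) w, p (r • TwModule.a _ (twEquiv cs w)))
    (m : TwModule (swapInvolution cs)) : p m := by
  induction m using Finsupp.induction_linear with
  | zero => exact zero
  | add a b ha hb => exact add _ _ ha hb
  | single w r =>
    obtain ⟨w, rfl⟩ := (twEquiv cs).surjective w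
    simpa [TwModule.a] using smul r w

/-- The first coordinate of an equality would read `s w = w`. Hence the two cases `s ⋉ w = s w` of
the module rule never arise. -/
theorem swap_inl_ne (i : B) (w : W) : (cs.prod cs).simple (Sum.inl i) * (twEquiv cs w).1 *
    (swapInvolution cs).star ((cs.prod cs).simple (Sum.inl i)) ≠ (twEquiv cs w).1 := by
  rw [cs.prod_simple_inl cs, twEquiv_val]
  intro h
  have h1 : cs.simple i * w * 1 = w := congrArg Prod.fst h
  rw [mul_one] at h1
  exact cs.length_simple_mul_ne w i (by rw [h1])

theorem swap_inr_ne (i : B) (w : W) : (cs.prod cs).simple (Sum.inr i) * (twEquiv cs w).1 *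
    (swapInvolution cs).star ((cs.prod cs).simple (Sum.inr i)) ≠ (twEquiv cs w).1 := by
  rw [cs.prod_simple_inr cs, twEquiv_val]
  intro h
  have h1 : 1 * w * cs.simple i = w := congrArg Prod.fst h
  rw [one_mul] at h1
  exact cs.length_mul_simple_ne w i (by rw [h1])

theorem act_inl (i : B) (w : W) : TwInv.act (swapInvolution cs) (Sum.inl i) (twEquiv cs w) =
    twEquiv cs (cs.simple i * w) := by
  apply (twEquiv cs).symm.injective
  rw [Equiv.symm_apply_apply]
  refine (congrArg Prod.fst (if_neg (swap_inl_ne cs i w))).trans ?_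
  rw [cs.prod_simple_inl cs]
  exact mul_one _

theorem act_inr (i : B) (w : W) : TwInv.act (swapInvolution cs) (Sum.inr i) (twEquiv cs w) =
    twEquiv cs (w * cs.simple i) := by
  apply (twEquiv cs).symm.injective
  rw [Equiv.symm_apply_apply]
  refine (congrArg Prod.fst (if_neg (swap_inr_ne cs i w))).trans ?_
  rw [cs.prod_simple_inr cs]
  exact congrArg (· * cs.simple i) (one_mul w)

theorem bruhatLT_mul_simple_iff (w : W) (i : B) :
    cs.BruhatLT w (w * cs.simple i) ↔ cs.length w < cs.length (w * cs.simple i) := by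
  have h := cs.bruhatLT_simple_mul_iff w⁻¹ i
  have e : cs.simple i * w⁻¹ = (w * cs.simple i)⁻¹ := by simp
  rw [e, cs.length_inv, cs.length_inv, CoxeterSystem.BruhatLT, cs.bruhatLE_inv_iff] at h
  rw [← h, CoxeterSystem.BruhatLT, Ne, Ne, inv_inj]

theorem twIso_twSimple_inl (i : B) (m : TwModule (swapInvolution cs)) :
    twIso cs (twSimple (swapInvolution cs) (Sum.inl i) m) =
      t cs (T 4) (cs.simple i) * twIso cs m := by
  induction m using twModule_induction with
  | zero => simp
  | add a b ha hb => simp only [map_add, ha, hb, mul_add]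
  | smul r w =>
    rw [map_smul, map_smul, map_smul, mul_smul_comm, twIso_a]
    congr 1
    rw [TwModule.a, twSimple, Finsupp.linearCombination_single, one_smul]
    simp only [if_neg (swap_inl_ne cs i w)]
    rw [act_inl, bruhatLT_twEquiv, cs.bruhatLT_simple_mul_iff]
    split_ifs with h
    · rw [twIso_a, simple_mul_t_of_lt cs _ h]
    · rw [map_add, map_smul, map_smul, twIso_a, twIso_a, simple_mul_t_of_not_lt cs _ h]

/-- Conjugating `(w, w⁻¹)` by `(1, s)` with the twist gives `(w s, s w⁻¹)`, so the two remaining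
cases are the rule for right multiplication by `T_s`. -/
theorem twIso_twSimple_inr (i : B) (m : TwModule (swapInvolution cs)) :
    twIso cs (twSimple (swapInvolution cs) (Sum.inr i) m) =
      twIso cs m * t cs (T 4) (cs.simple i) := by
  induction m using twModule_induction with
  | zero => simp
  | add a b ha hb => simp only [map_add, ha, hb, add_mul]
  | smul r w =>
    rw [map_smul, map_smul, map_smul, smul_mul_assoc, twIso_a]
    congr 1
    rw [TwModule.a, twSimple, Finsupp.linearCombination_single, one_smul]
    simp only [if_neg (swap_inr_ne cs i w)]
    rw [act_inr, bruhatLT_twEquiv, bruhatLT_mul_simple_iff]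
    split_ifs with h
    · rw [twIso_a, t_mul_simple_of_lt cs _ h]
    · rw [map_add, map_smul, map_smul, twIso_a, twIso_a, t_mul_simple_of_not_lt cs _ h]

/-- Letters `(s, 1)` accumulate on the left and letters `(1, s)` on the right in reversed order,
hence the inverse of the second component. Reducedness of `ω` keeps every multiplication in the
length-increasing case. -/
theorem twIso_word (ω : List (B ⊕ B)) (hω : (cs.prod cs).IsReduced ω)
    (m : TwModule (swapInvolution cs)) :
    twIso cs ((ω.map (twSimple (swapInvolution cs))).prod m) =
      t cs (T 4) ((cs.prod cs).wordProd ω).1 * twIso cs m *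
        t cs (T 4) ((cs.prod cs).wordProd ω).2⁻¹ := by
  induction ω with
  | nil => simp [t_one]
  | cons i ω ih =>
    have h' : (cs.prod cs).IsReduced ω := by simpa using hω.drop 1
    have h1 := hω.eq
    rw [CoxeterSystem.wordProd_cons, List.length_cons, ← h'.eq] at h1
    rw [List.map_cons, List.prod_cons, Module.End.mul_apply, CoxeterSystem.wordProd_cons]
    generalize (cs.prod cs).wordProd ω = v at h1 ih ⊢
    rw [cs.prod_length, cs.prod_length] at h1
    rcases i with i | i
    · rw [twIso_twSimple_inl, ih h', cs.prod_simple_inl cs, Prod.fst_mul, Prod.snd_mul, one_mul,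
        ← mul_assoc, ← mul_assoc, simple_mul_t_of_lt]
      rw [cs.prod_simple_inl cs, Prod.fst_mul, Prod.snd_mul, one_mul] at h1
      dsimp only at h1
      omega
    · rw [twIso_twSimple_inr, ih h', cs.prod_simple_inr cs, Prod.fst_mul, Prod.snd_mul, one_mul,
        mul_inv_rev, cs.inv_simple, mul_assoc, t_mul_simple_of_lt]
      rw [cs.prod_simple_inr cs, Prod.fst_mul, Prod.snd_mul, one_mul] at h1
      dsimp only at h1
      have e : v.2⁻¹ * cs.simple i = (cs.simple i * v.2)⁻¹ := by simp
      rw [e, cs.length_inv, cs.length_inv]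
      omega

theorem twIso_twAction_t (w : W × W) (m : TwModule (swapInvolution cs)) :
    twIso cs (twAction (swapInvolution cs) (t (cs.prod cs) (T 4) w) m) =
      t cs (T 4) w.1 * twIso cs m * t cs (T 4) w.2⁻¹ := by
  have e : twAction (swapInvolution cs) (t (cs.prod cs) (T 4) w) =
      (((cs.prod cs).reducedWord w).map (twSimple (swapInvolution cs))).prod :=
    (Finsupp.linearCombination_single _ _ _).trans (one_smul _ _)
  rw [e, twIso_word cs _ ((cs.prod cs).isReduced_reducedWord w),
    (cs.prod cs).wordProd_reducedWord]

theorem twIso_twAction (x y : HeckeAlgebra cs (T 4 : ℤ[T;T⁻¹]))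
    (m : TwModule (swapInvolution cs)) :
    twIso cs (twAction (swapInvolution cs) (inl cs cs (T 4) x * inr cs cs (T 4) y) m) =
      x * twIso cs m * flip cs (T 4) y := by
  induction x using induction with
  | zero => simp
  | add a b ha hb => simp only [map_add, add_mul, LinearMap.add_apply, ha, hb]
  | smul r v =>
    induction y using induction with
    | zero => simp
    | add a b ha hb => simp only [map_add, mul_add, LinearMap.add_apply, ha, hb]
    | smul s w =>
      rw [map_smul, map_smul, smul_mul_smul_comm, inl_t_mul_inr_t, map_smul, LinearMap.smul_apply,
        map_smul, twIso_twAction_t, map_smul, flip_t, smul_mul_assoc, smul_mul_smul_comm]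

theorem heckeBar_smul_t (r : ℤ[T;T⁻¹]) (w : W × W) :
    heckeBar (cs.prod cs) (T 4) (r • t (cs.prod cs) (T 4) w) =
      LaurentPolynomial.invert r • (inl cs cs (T 4) (bar cs 4 (t cs (T 4) w.1)) *
        inr cs cs (T 4) (bar cs 4 (t cs (T 4) w.2))) := by
  rw [← bar_apply, bar_smul, ← inl_t_mul_inr_t, map_mul, bar_inl, bar_inr]

/-- The bar operator of the Hecke algebra, transported to the module of twisted involutions. -/
def twBarAddHom : TwModule (swapInvolution cs) →+ TwModule (swapInvolution cs) :=
  ((twIso cs).symm.toLinearMap.toAddMonoidHom.comp (bar cs 4 : _ →+* _).toAddMonoidHom).comp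
    (twIso cs).toLinearMap.toAddMonoidHom

theorem twIso_twBarAddHom (m : TwModule (swapInvolution cs)) :
    twIso cs (twBarAddHom cs m) = bar cs 4 (twIso cs m) :=
  (twIso cs).apply_symm_apply _

theorem one_eq_twEquiv : TwInv.one (swapInvolution cs) = twEquiv cs 1 :=
  Subtype.ext (Prod.ext rfl inv_one.symm)

/-- Compatibility with the action reduces to the bar operator being multiplicative and commuting
with `flip`. -/
theorem isTwBar_twBarAddHom : IsTwBar (swapInvolution cs) (twBarAddHom cs) where
  involutive m := (twIso cs).injective (by
    rw [twIso_twBarAddHom, twIso_twBarAddHom, bar_bar])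
  map_one := (twIso cs).injective (by
    rw [twIso_twBarAddHom, one_eq_twEquiv, twIso_a, t_one, map_one])
  map_act h m := (twIso cs).injective (by
    rw [twIso_twBarAddHom]
    induction h using induction with
    | zero =>
      rw [← bar_apply]
      simp
    | add a b ha hb =>
      rw [← bar_apply] at ha hb ⊢
      simp only [map_add, LinearMap.add_apply, ha, hb]
    | smul r w =>
      rw [heckeBar_smul_t, map_smul (twAction _), map_smul (twAction _), LinearMap.smul_apply,
        LinearMap.smul_apply, map_smul (twIso cs), map_smul (twIso cs), twIso_twAction, twIso_twAction_t, bar_smul, map_mul, map_mul, twIso_twBarAddHom,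
        ← bar_flip, flip_t])

/-- Every `m` is `h · a_1` for an `h` in the left copy of the Hecke algebra, so the axioms determine
the bar operator. This identifies the operator selected by choice in `twBar`. -/
theorem twIso_apply_of_isTwBar {b : TwModule (swapInvolution cs) →+ TwModule (swapInvolution cs)}
    (hb : IsTwBar (swapInvolution cs) b) (m : TwModule (swapInvolution cs)) :
    twIso cs (b m) = bar cs 4 (twIso cs m) := by
  have hm : m = twAction (swapInvolution cs) (inl cs cs (T 4) (twIso cs m) * inr cs cs (T 4) 1)
      (TwModule.a _ (TwInv.one _)) := (twIso cs).injective (by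
    rw [twIso_twAction, one_eq_twEquiv, twIso_a, t_one, flip_one, mul_one, mul_one])
  conv_lhs => rw [hm]
  rw [hb.map_act, hb.map_one, ← bar_apply, map_mul, bar_inl, bar_inr, twIso_twAction,
    one_eq_twEquiv, twIso_a, t_one, map_one, flip_one, mul_one, mul_one]

theorem twIso_twBar (m : TwModule (swapInvolution cs)) :
    twIso cs (twBar (swapInvolution cs) m) = bar cs 4 (twIso cs m) := by
  have h : ∃ b, IsTwBar (swapInvolution cs) b := ⟨_, isTwBar_twBarAddHom cs⟩
  rw [twBar, dif_pos h]
  exact twIso_apply_of_isTwBar cs h.choose_spec m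

theorem repr_twIso_twCombination (w y : W) (P : TwInv (swapInvolution cs) →₀ ℤ[X]) :
    (basis cs (T 4)).repr (twIso cs (twCombination (swapInvolution cs) (twEquiv cs w) P)) y =
      T (-2 * (cs.length w : ℤ)) * evalT 2 (P (twEquiv cs y)) := by
  classical
  have e : (-((cs.prod cs).length (twEquiv cs w).1 : ℤ)) = -2 * (cs.length w : ℤ) := by
    rw [length_twEquiv]; push_cast; ring
  rw [repr_twIso, twCombination, e, Finsupp.smul_apply, smul_eq_mul, Finsupp.sum,
    Finsupp.finsetSum_apply, Finset.sum_eq_single (twEquiv cs y)]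
  · simp [TwModule.a, evalT_apply]
  · intro b _ hb
    simp [TwModule.a, hb]
  · intro h
    rw [Finsupp.notMem_support_iff.1 h]
    simp

/-- The family `P_{y,w}(q²)`. -/
def sqFamily (w : W) : TwInv (swapInvolution cs) →₀ ℤ[X] :=
  ((klFamily cs w).mapRange (fun p => p.comp (X ^ 2)) (zero_comp)).equivMapDomain (twEquiv cs)

theorem sqFamily_apply (w y : W) : sqFamily cs w (twEquiv cs y) = (klP cs y w).comp (X ^ 2) := by
  rw [sqFamily, Finsupp.equivMapDomain_apply, Equiv.symm_apply_apply, Finsupp.mapRange_apply, klP]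

theorem twIso_twCombination_sqFamily (w : W) :
    twIso cs (twCombination (swapInvolution cs) (twEquiv cs w) (sqFamily cs w)) = klC cs w :=
  (basis cs _).repr.injective (Finsupp.ext fun y => by
    rw [repr_twIso_twCombination, sqFamily_apply, evalT_two_comp, klC_eq, map_smul,
      Finsupp.smul_apply, smul_eq_mul, spec, repr_baseChange, repr_klElement_apply])

/-- Replacing `q` by `q²` doubles degrees just as passing to `(w, w⁻¹)` doubles lengths, so the
bound for `P_{y,w}` implies the twisted one. Bar invariance is that of `C_w`. -/
theorem isTwKLFamily_sqFamily (w : W) :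
    IsTwKLFamily (swapInvolution cs) (twEquiv cs w) (sqFamily cs w) := by
  have h : IsKLFamily cs w (klFamily cs w) := by
    rw [← repr_klElement]
    exact isKLFamily_repr.2 (isKLElement_klElement cs w)
  refine ⟨(twIso cs).injective ?_, ?_, fun y hy hne => ?_, fun y hy => ?_⟩
  · rw [twIso_twBar, twIso_twCombination_sqFamily, bar_klC]
  · rw [sqFamily_apply, klP, h.eq_one, one_comp]
  · obtain ⟨y, rfl⟩ := (twEquiv cs).surjective y
    rw [bruhatLT_twEquiv] at hy
    rw [sqFamily_apply, klP, h.eq_zero y hy (fun e => hne (by rw [e])), zero_comp]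
  · obtain ⟨y, rfl⟩ := (twEquiv cs).surjective y
    rw [bruhatLT_twEquiv] at hy
    have := h.degree_le y hy
    rw [sqFamily_apply, klP, natDegree_comp, natDegree_X_pow, length_twEquiv, length_twEquiv]
    omega

/-- The argument of `IsKLElement.unique`, now in the Hecke algebra with parameter `v⁴`. Competing
families need not be polynomials in `q²`. -/
theorem isTwKLFamily_unique {w : W} {P P' : TwInv (swapInvolution cs) →₀ ℤ[X]}
    (h : IsTwKLFamily (swapInvolution cs) (twEquiv cs w) P)
    (h' : IsTwKLFamily (swapInvolution cs) (twEquiv cs w) P') : P = P' := by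
  have hbar : ∀ {P}, IsTwKLFamily (swapInvolution cs) (twEquiv cs w) P →
      bar cs 4 (twIso cs (twCombination (swapInvolution cs) (twEquiv cs w) P)) =
        twIso cs (twCombination (swapInvolution cs) (twEquiv cs w) P) := fun h => by
    rw [← twIso_twBar, h.bar_eq]
  -- With doubled lengths the degree bound says that the degree in `q` is less than `ℓ(w) - ℓ(y)`.
  have hcoeff : ∀ {P}, IsTwKLFamily (swapInvolution cs) (twEquiv cs w) P → ∀ y ≠ w, ∀ j,
      cs.length w ≤ j + cs.length y → (P (twEquiv cs y)).coeff j = 0 := fun h y hy j hj => by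
    by_cases hlt : (cs.prod cs).BruhatLT (twEquiv cs y).1 (twEquiv cs w).1
    · have := h.degree_le _ hlt
      rw [length_twEquiv, length_twEquiv] at this
      exact coeff_eq_zero_of_natDegree_lt (by omega)
    · rw [h.eq_zero _ hlt (fun e => hy ((twEquiv cs).injective e)), coeff_zero]
  have key := eq_zero_of_bar_eq cs 4 (m := 2) (by norm_num)
    (x := twIso cs (twCombination (swapInvolution cs) (twEquiv cs w) P) -
      twIso cs (twCombination (swapInvolution cs) (twEquiv cs w) P'))
    (by rw [map_sub, hbar h, hbar h'])
    (fun y e he => by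
      rw [map_sub, Finsupp.sub_apply, repr_twIso_twCombination, repr_twIso_twCombination, ← mul_sub,
        ← map_sub, ← mul_assoc, ← LaurentPolynomial.T_add]
      refine coeff_T_mul_evalT (fun j hj => ?_) e he
      rw [coeff_sub]
      by_cases hy : y = w
      · rw [hy, h.eq_one, h'.eq_one, sub_self]
      · rw [hcoeff h y hy j (by omega), hcoeff h' y hy j (by omega), sub_self])
  rw [sub_eq_zero] at key
  refine Finsupp.ext fun y => ?_
  obtain ⟨y, rfl⟩ := (twEquiv cs).surjective y
  have h1 := DFunLike.congr_fun (congrArg (basis cs (T 4 : ℤ[T;T⁻¹])).repr key) y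
  rw [repr_twIso_twCombination, repr_twIso_twCombination] at h1
  exact evalT_injective ((LaurentPolynomial.isUnit_T _).mul_left_cancel h1)

theorem twKLFamily_eq (w : W) :
    twKLFamily (swapInvolution cs) (twEquiv cs w) = sqFamily cs w := by
  have h : ∃ P, IsTwKLFamily (swapInvolution cs) (twEquiv cs w) P := ⟨_, isTwKLFamily_sqFamily cs w⟩
  rw [twKLFamily, dif_pos h]
  exact isTwKLFamily_unique cs h.choose_spec (isTwKLFamily_sqFamily cs w)

theorem twP_eq (y w : W) : twP (swapInvolution cs) (twEquiv cs y) (twEquiv cs w) =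
    (klP cs y w).comp (X ^ 2) := by
  rw [twP, twKLFamily_eq, sqFamily_apply]

theorem twIso_twA (w : W) : twIso cs (twA (swapInvolution cs) (twEquiv cs w)) = klC cs w := by
  rw [twA, twKLFamily_eq, twIso_twCombination_sqFamily]

theorem klP_twEquiv (y w : W) :
    klP (cs.prod cs) (twEquiv cs y).1 (twEquiv cs w).1 = klP cs y w ^ 2 := by
  rw [klP_prod, twEquiv_val, twEquiv_val, klP_inv, sq]

/-- The isomorphism turns `C_x A_y` into `C_{x₁} C_y C_{x₂⁻¹}`, the inverse coming from the flip on
the second factor; this is `heckeSq` of the corresponding product of the `c`. -/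
theorem twH_eq (x : W × W) (y z : W) :
    twH (swapInvolution cs) x (twEquiv cs y) (twEquiv cs z) =
      laurentSq (klF cs x.1 y x.2⁻¹ z) := by
  have hb : ∀ w, (((klCBasis cs).map (twIso cs).symm).reindex (twEquiv cs)) w =
      twA (swapInvolution cs) w := fun w => by
    obtain ⟨w, rfl⟩ := (twEquiv cs).surjective w
    rw [Module.Basis.reindex_apply, Equiv.symm_apply_apply, Module.Basis.map_apply, klCBasis_apply,
      ← twIso_twA, LinearEquiv.symm_apply_apply]
  rw [twH, coords_eq_of_eq_basis _ hb, Module.Basis.repr_reindex_apply, Equiv.symm_apply_apply,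
    Module.Basis.map_repr, LinearEquiv.trans_apply, LinearEquiv.symm_symm, klC_prod, twIso_twAction,
    twIso_twA, flip_klC, ← heckeSq_klc, ← heckeSq_klc, ← heckeSq_klc, ← map_mul, ← map_mul,
    klCBasis_repr_heckeSq, klF_eq]

/-- As `(x^*)⁻¹ = (x₂⁻¹, x₁⁻¹)`, the second tensor factor is the flip of the first; its coefficient
at `z⁻¹` equals that of the first at `z`, whence a square. -/
theorem klHTilde_eq (x : W × W) (y z : W) :
    klHTilde (swapInvolution cs) x (twEquiv cs y) (twEquiv cs z).1 =
      klF cs x.1 y x.2⁻¹ z ^ 2 := by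
  have hx : ((swapInvolution cs).star x)⁻¹ = (x.2⁻¹, x.1⁻¹) := rfl
  have hflip : klc cs x.2 * klc cs y⁻¹ * klc cs x.1⁻¹ =
      flip cs (T 2) (klc cs x.1 * klc cs y * klc cs x.2⁻¹) := by
    rw [flip_mul, flip_mul, flip_klc, flip_klc, flip_klc, inv_inv, mul_assoc]
  rw [klHTilde, coords_eq_of_eq_basis _ (klcBasis_apply _), hx, klc_prod, klc_prod, klc_prod,
    inl_mul_inr_mul, inl_mul_inr_mul, klcBasis_repr_inl_mul_inr, twEquiv_val, twEquiv_val]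
  dsimp only
  rw [hflip, klcBasis_repr_flip, klF_eq, sq]

theorem signP_eq (ε : ℤˣ) (y w : W) :
    signP (swapInvolution cs) ε (twEquiv cs y) (twEquiv cs w) = (1 / 2 : ℚ) •
      (polyToRat (klP cs y w) ^ 2 + (ε : ℤ) • polyToRat ((klP cs y w).comp (X ^ 2))) := by
  rw [signP, klP_twEquiv, twP_eq, map_pow]

theorem signH_eq (ε : ℤˣ) (x : W × W) (y z : W) :
    signH (swapInvolution cs) ε x (twEquiv cs y) (twEquiv cs z) = (1 / 2 : ℚ) •
      (laurentToRat (klF cs x.1 y x.2⁻¹ z) ^ 2 +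
        (ε : ℤ) • laurentToRat (laurentSq (klF cs x.1 y x.2⁻¹ z))) := by
  rw [signH, klHTilde_eq, twH_eq, map_pow]

end SwapInvolution

end

theorem mainTheorem4 {B W : Type*} [Group W] {M : CoxeterMatrix B} (cs : CoxeterSystem M W)
    (ε : ℤˣ) :
    {p : ℚ[X] | ∃ y w : TwInv (swapInvolution cs), p = signP (swapInvolution cs) ε y w} =
      {p : ℚ[X] | ∃ y w : W, p = (1 / 2 : ℚ) •
        (polyToRat (klP cs y w) ^ 2 + (ε : ℤ) • polyToRat ((klP cs y w).comp (X ^ 2)))} ∧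
    {p : ℚ[X] | ∃ y z w : TwInv (swapInvolution cs), (cs.prod cs).BruhatLE y z ∧
        p = signP (swapInvolution cs) ε y w - signP (swapInvolution cs) ε z w} =
      {p : ℚ[X] | ∃ y z w : W, cs.BruhatLE y z ∧
        p = (1 / 2 : ℚ) • (polyToRat (klP cs y w) ^ 2 - polyToRat (klP cs z w) ^ 2) +
          (ε : ℤ) • ((1 / 2 : ℚ) • (polyToRat ((klP cs y w).comp (X ^ 2)) -
            polyToRat ((klP cs z w).comp (X ^ 2))))} ∧
    {p : ℚ[T;T⁻¹] | ∃ (x : W × W) (y z : TwInv (swapInvolution cs)),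
        p = signH (swapInvolution cs) ε x y z} =
      {p : ℚ[T;T⁻¹] | ∃ w x y z : W, p = (1 / 2 : ℚ) •
        (laurentToRat (klF cs w x y z) ^ 2 +
          (ε : ℤ) • laurentToRat (laurentSq (klF cs w x y z)))} := by
  refine ⟨Set.ext fun p => ?_, Set.ext fun p => ?_, Set.ext fun p => ?_⟩
  -- Quantifiers over twisted involutions are reindexed by `w ↦ (w, w⁻¹)`.
  · simp only [Set.mem_ofPred_eq, ← (SwapInvolution.twEquiv cs).exists_congr_right,
      SwapInvolution.signP_eq]
  · simp only [Set.mem_ofPred_eq, ← (SwapInvolution.twEquiv cs).exists_congr_right,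
      SwapInvolution.signP_eq, SwapInvolution.bruhatLE_twEquiv]
    refine exists_congr fun y => exists_congr fun z => exists_congr fun w => and_congr_right' ?_
    rw [smul_comm (ε : ℤ) (1 / 2 : ℚ), ← smul_add, ← smul_sub, add_sub_add_comm, ← smul_sub]
  · simp only [Set.mem_ofPred_eq, ← (SwapInvolution.twEquiv cs).exists_congr_right,
      SwapInvolution.signH_eq]
    constructor
    · rintro ⟨x, y, z, rfl⟩
      exact ⟨x.1, y, x.2⁻¹, z, rfl⟩
    · rintro ⟨w, x, y, z, rfl⟩
      -- The second component acts on the right through its inverse, hence `y⁻¹`.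
      exact ⟨(w, y⁻¹), x, z, by rw [inv_inv]⟩
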